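/- Let $A=\{a,b\}$, let $A^+$ be the free semigroup on $A$, and let $\varphi\colon A^+\to A^+$ be the endomorphism (substitution) given by $\varphi(a)=ab$ and $\varphi(b)=a^3b$. Let $L$ be the set of factors of the words $\varphi^k(c)$ with $c\in A$ and $k\ge 1$ sufficiently large (the language of the minimal subshift defined by $\varphi$). Let $\overline{\Omega}_A\mathsf{S}$ be the free profinite semigroup on $A$, i.e. the profinite completion of $A^+$, and let $J(\varphi)=\overline{L}\setminus L$, where $\overline{L}$ is the topological closure of $L$ in $\overline{\Omega}_A\mathsf{S}$; this is the regular $\mathcal J$-class of $\overline{\Omega}_A\mathsf{S}$ associated with the subshift. The Schützenberger group $G(\varphi)$ is the profinite group given by any maximal subgroup contained in $J(\varphi)$, i.e. the group of units of $e\,\overline{\Omega}_A\mathsf{S}\,e$ for an idempotent $e\in J(\varphi)$, with the subspace topology. Then $J(\varphi)$ contains an idempotent, and $G(\varphi)$ is not a relatively free profinite group: for every idempotent $e\in J(\varphi)$, there are no pseudovariety $\mathsf V$ of groups (nonempty class of finite groups closed under subgroups, homomorphic images and finite direct products) and set $X$ such that the maximal subgroup with identity $e$ is the free pro-$\mathsf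 V$ group on $X$. -/

import Mathlib

open Filter Topology

/-! ### The free profinite semigroup -/

/-- `u` is a factor of `v`, that is, `v ∈ S¹ u S¹`. -/
def IsFactor {S : Type*} [Semigroup S] (u v : S) : Prop :=
  ∃ x y : WithOne S, (v : WithOne S) = x * (u : WithOne S) * y

/-- The congruences on the free semigroup `A⁺` with finite quotient. -/
def FiniteIndexCon (A : Type) : Type :=
  { c : Con (FreeSemigroup A) // Finite c.Quotient }

/-- The finite quotient of `A⁺` by a finite index congruence, regarded as a discrete space. -/
def FinQuot {A : Type} (c : FiniteIndexCon A) : Type := c.1.Quotient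

noncomputable instance {A : Type} (c : FiniteIndexCon A) : Semigroup (FinQuot c) :=
  inferInstanceAs (Semigroup c.1.Quotient)

instance {A : Type} (c : FiniteIndexCon A) : Finite (FinQuot c) := c.2

instance {A : Type} (c : FiniteIndexCon A) : TopologicalSpace (FinQuot c) := ⊥

instance {A : Type} (c : FiniteIndexCon A) : DiscreteTopology (FinQuot c) := ⟨rfl⟩

/-- The diagonal homomorphism from `A⁺` to the product of all its finite quotients. -/
noncomputable def toProd (A : Type) : FreeSemigroup A →ₙ* (∀ c : FiniteIndexCon A, FinQuot c) where
  toFun w := fun c => (w : c.1.Quotient)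
  map_mul' _ _ := rfl

/-- The free profinite semigroup on `A` (for `A` finite): the profinite completion of `A⁺`,
that is, the closure of `A⁺` in the product of all its finite quotients. -/
abbrev FreeProfiniteSemigroup (A : Type) : Type :=
  (toProd A).srange.topologicalClosure

instance (A : Type) : CompactSpace (FreeProfiniteSemigroup A) :=
  isCompact_iff_compactSpace.mp
    (Subsemigroup.isClosed_topologicalClosure (toProd A).srange).isCompact

/-- The canonical homomorphism from `A⁺` to the free profinite semigroup on `A`. -/
noncomputable def wordToProfinite (A : Type) : FreeSemigroup A →ₙ* FreeProfiniteSemigroup A where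
  toFun w := ⟨toProd A w, Subsemigroup.le_topologicalClosure _ ⟨w, rfl⟩⟩
  map_mul' u v := Subtype.ext (map_mul (toProd A) u v)

/-! ### Maximal subgroups -/

/-- The maximal subgroup, with identity `e`, of a semigroup: the group of units of `e S e`,
with the subspace topology when the semigroup has a topology. -/
def MaximalSubgroup {S : Type*} [Semigroup S] (e : S) (_he : IsIdempotentElem e) : Type _ :=
  { x : S // e * x = x ∧ x * e = x ∧ ∃ y : S, e * y = y ∧ y * e = y ∧ x * y = e ∧ y * x = e }

namespace MaximalSubgroup

section Group

variable {S : Type*} [Semigroup S] {e : S} {he : IsIdempotentElem e}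

theorem ext {x y : MaximalSubgroup e he} (h : x.1 = y.1) : x = y := Subtype.ext h

instance : Mul (MaximalSubgroup e he) where
  mul x y := ⟨x.1 * y.1, by
    obtain ⟨x, hx1, hx2, x', hx3, hx4, hx5, hx6⟩ := x
    obtain ⟨y, hy1, hy2, y', hy3, hy4, hy5, hy6⟩ := y
    change e * (x * y) = x * y ∧ x * y * e = x * y ∧ _
    refine ⟨by rw [← mul_assoc, hx1], by rw [mul_assoc, hy2], y' * x', by rw [← mul_assoc, hy3],
      by rw [mul_assoc, hx4], ?_, ?_⟩
    · calc x * y * (y' * x') = x * ((y * y') * x') := by simp only [mul_assoc]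
        _ = e := by rw [hy5, hx3, hx5]
    · calc y' * x' * (x * y) = y' * ((x' * x) * y) := by simp only [mul_assoc]
        _ = e := by rw [hx6, hy1, hy6]⟩

instance : One (MaximalSubgroup e he) where
  one := ⟨e, he, he, e, he, he, he, he⟩

noncomputable instance : Inv (MaximalSubgroup e he) where
  inv x := ⟨x.2.2.2.choose, by
    obtain ⟨h1, h2, h3, h4⟩ := x.2.2.2.choose_spec
    exact ⟨h1, h2, x.1, x.2.1, x.2.2.1, h4, h3⟩⟩

theorem val_mul (x y : MaximalSubgroup e he) : (x * y).1 = x.1 * y.1 := rfl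

theorem val_one : (1 : MaximalSubgroup e he).1 = e := rfl

noncomputable instance : Group (MaximalSubgroup e he) :=
  Group.ofLeftAxioms (fun x y z => ext (mul_assoc x.1 y.1 z.1)) (fun x => ext x.2.1)
    (fun x => ext x.2.2.2.choose_spec.2.2.2)

end Group

section Topology

variable {S : Type*} [Semigroup S] [TopologicalSpace S] {e : S} {he : IsIdempotentElem e}

instance : TopologicalSpace (MaximalSubgroup e he) :=
  inferInstanceAs (TopologicalSpace (Subtype _))

theorem continuous_val : Continuous (fun x : MaximalSubgroup e he => x.1) :=
  continuous_subtype_val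

instance [T2Space S] : T2Space (MaximalSubgroup e he) :=
  inferInstanceAs (T2Space (Subtype _))

instance [TotallyDisconnectedSpace S] : TotallyDisconnectedSpace (MaximalSubgroup e he) :=
  inferInstanceAs (TotallyDisconnectedSpace (Subtype _))

variable [ContinuousMul S] [T2Space S]

/-- The pairs of mutually inverse elements of the maximal subgroup. -/
def pairs (e : S) : Set (S × S) :=
  { p | e * p.1 = p.1 ∧ p.1 * e = p.1 ∧ e * p.2 = p.2 ∧ p.2 * e = p.2 ∧
    p.1 * p.2 = e ∧ p.2 * p.1 = e }

theorem isClosed_pairs (e : S) : IsClosed (pairs e) := by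
  unfold pairs
  refine IsClosed.inter (isClosed_eq (by fun_prop) (by fun_prop)) ?_
  refine IsClosed.inter (isClosed_eq (by fun_prop) (by fun_prop)) ?_
  refine IsClosed.inter (isClosed_eq (by fun_prop) (by fun_prop)) ?_
  refine IsClosed.inter (isClosed_eq (by fun_prop) (by fun_prop)) ?_
  exact IsClosed.inter (isClosed_eq (by fun_prop) (by fun_prop))
    (isClosed_eq (by fun_prop) (by fun_prop))

variable [CompactSpace S]

instance : CompactSpace (MaximalSubgroup e he) := by
  have h : IsCompact (Prod.fst '' pairs e) := (isClosed_pairs e).isCompact.image continuous_fst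
  refine (isCompact_iff_compactSpace (s := { x : S | e * x = x ∧ x * e = x ∧
    ∃ y : S, e * y = y ∧ y * e = y ∧ x * y = e ∧ y * x = e })).mp ?_
  convert h using 1
  ext x
  constructor
  · rintro ⟨h1, h2, y, h3⟩
    exact ⟨(x, y), ⟨h1, h2, h3⟩, rfl⟩
  · rintro ⟨⟨x', y⟩, ⟨h1, h2, h3⟩, rfl⟩
    exact ⟨h1, h2, y, h3⟩

instance : IsTopologicalGroup (MaximalSubgroup e he) where
  continuous_mul := by
    refine Continuous.subtype_mk (?_ : Continuous
      fun p : MaximalSubgroup e he × MaximalSubgroup e he => p.1.1 * p.2.1) _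
    exact (continuous_val.comp continuous_fst).mul (continuous_val.comp continuous_snd)
  continuous_inv := by
    refine continuous_iff_isClosed.mpr fun C hC => ?_
    have h : IsClosed { p : MaximalSubgroup e he × MaximalSubgroup e he |
        p.1.1 * p.2.1 = e ∧ p.2 ∈ C } :=
      (isClosed_eq ((continuous_val.comp continuous_fst).mul
        (continuous_val.comp continuous_snd)) continuous_const).inter (hC.preimage continuous_snd)
    convert (h.isCompact.image continuous_fst).isClosed using 1
    ext x
    constructor
    · intro hx
      exact ⟨(x, x⁻¹), ⟨congrArg Subtype.val (mul_inv_cancel x), hx⟩, rfl⟩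
    · rintro ⟨⟨x, y⟩, ⟨h1, h2⟩, rfl⟩
      have h3 : x⁻¹ = y := inv_eq_of_mul_eq_one_right (ext h1)
      change x⁻¹ ∈ C
      rwa [h3]

end Topology

end MaximalSubgroup

/-! ### Relatively free profinite groups -/

/-- A pseudovariety of groups: a nonempty class of finite groups closed under taking subgroups,
homomorphic images and finite direct products. -/
structure GroupPseudovariety where
  Mem : (G : Type) → [Group G] → Prop
  finite : ∀ (G : Type) [Group G], Mem G → Finite G
  unit : Mem PUnit
  subgroup : ∀ (G H : Type) [Group G] [Group H] (f : H →* G),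
    Function.Injective f → Mem G → Mem H
  quotient : ∀ (G H : Type) [Group G] [Group H] (f : G →* H),
    Function.Surjective f → Mem G → Mem H
  prod : ∀ (G H : Type) [Group G] [Group H], Mem G → Mem H → Mem (G × H)

/-- A profinite group is pro-`V` if all its finite continuous quotients are in `V`. -/
def IsPro (V : GroupPseudovariety) (P : Type) [Group P] [TopologicalSpace P]
    [IsTopologicalGroup P] [CompactSpace P] [T2Space P] [TotallyDisconnectedSpace P] : Prop :=
  ∀ N : OpenNormalSubgroup P, V.Mem (P ⧸ N.toSubgroup)

/-- The profinite group `F` is the free pro-`V` group on the set `X`, via `ι : X → F`. -/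
def IsFreePro (V : GroupPseudovariety) {X F : Type} [Group F] [TopologicalSpace F]
    [IsTopologicalGroup F] [CompactSpace F] [T2Space F] [TotallyDisconnectedSpace F]
    (ι : X → F) : Prop :=
  IsPro V F ∧
    ∀ (P : Type) [Group P] [TopologicalSpace P] [IsTopologicalGroup P] [CompactSpace P]
      [T2Space P] [TotallyDisconnectedSpace P], IsPro V P →
      ∀ f : X → P, ∃! g : F →ₜ* P, ∀ x, g (ι x) = f x

/-- A profinite group is relatively free if it is the free pro-`V` group on some set, for some
pseudovariety of groups `V`. -/
def IsRelativelyFree (H : Type) [Group H] [TopologicalSpace H]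
    [IsTopologicalGroup H] [CompactSpace H] [T2Space H] [TotallyDisconnectedSpace H] : Prop :=
  ∃ (V : GroupPseudovariety) (X : Type) (ι : X → H), IsFreePro V ι

/-! ### Substitutions -/

/-- The language of the subshift of a substitution `φ`: the factors of the words `φ^k(c)`
with `c` a letter and `k` sufficiently large. -/
def substLanguage {A : Type} (φ : FreeSemigroup A →ₙ* FreeSemigroup A) : Set (FreeSemigroup A) :=
  { w | ∀ᶠ k : ℕ in atTop, ∃ c : A, IsFactor w (φ^[k] (FreeSemigroup.of c)) }

/-- The `J`-class associated with the subshift of a (weakly primitive) substitution `φ`: the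
closure of its language in the free profinite semigroup, without the language itself. -/
def substJClass {A : Type} (φ : FreeSemigroup A →ₙ* FreeSemigroup A) :
    Set (FreeProfiniteSemigroup A) :=
  closure (wordToProfinite A '' substLanguage φ) \ (wordToProfinite A '' substLanguage φ)

/-- The two-letter alphabet. -/
inductive Letter where
  | a : Letter
  | b : Letter

/-- The substitution `a ↦ ab`, `b ↦ aaab`. -/
def phi : FreeSemigroup Letter →ₙ* FreeSemigroup Letter :=
  FreeSemigroup.lift fun c => match c with
    | Letter.a => FreeSemigroup.of Letter.a * FreeSemigroup.of Letter.b
    | Letter.b => FreeSemigroup.of Letter.a * FreeSemigroup.of Letter.a *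
        FreeSemigroup.of Letter.a * FreeSemigroup.of Letter.b

/-! The obstruction to relative freeness is a mismatch at the prime 2 (`not_isRelativelyFree`). If
the free pro-`V` group on `X` has a finite continuous quotient containing an involution, then the
group of order two lies in `V`. If `X` is nonempty, sending generators to the involution gives a
quotient of order two; if `X` is empty, the group is trivial. The group `G(φ)` has such an
involution but no continuous quotient of order two.

Both facts are read off generators. The elements `φ^ω(a)` and `φ^ω(b)` lie in one maximal subgroup
of `J(φ)` (`exists_maximalSubgroup_omegaPower`) and generate it topologically (`denseRange_lift`).
Generation rests on recognizability: occurrences of `φⁿ(abaaab)` start at cuts of order `n`, so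
words approximating group elements are themselves images under `φⁿ`.

Every letter occurs an even number of times in `φ²(a)` and in `φ²(b)`, which kills all characters of
order two (`eq_one_of_isOpen_ker`). On the other hand, a 3-cycle `x` and a double transposition `y`
in the alternating group of degree 4 satisfy `φ²(x, y) = (x, y)`, so `φ^ω(b)` maps to the involution
`y` (`exists_openNormalSubgroup`).

Any two idempotents of `J(φ)` are `J`-equivalent, hence have isomorphic maximal subgroups, so one
idempotent suffices. -/

/-! ### Compact semigroups -/

section CompactSemigroup

variable {S : Type*} [Semigroup S] [TopologicalSpace S] [ContinuousMul S] [CompactSpace S]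
  [T2Space S]

/-- The right half of stability of compact semigroups. -/
theorem exists_eq_mul_right_of_eq_mul_mul {x p q : S} (h : x = p * x * q) :
    ∃ r, x = x * q * r := by
  -- The pairs `(P, Q)` with `x = PxQ` and `Q ∈ qS` form a closed subsemigroup of `S × Sᵐᵒᵖ`. An
  -- idempotent pair in it gives `x = PxQ = PxQQ = xQ`.
  have hcl : IsClosed ({ z : S × Sᵐᵒᵖ | x = z.1 * x * z.2.unop } ∩
      (fun z => z.2.unop) ⁻¹' Set.range fun r => q * r) := by
    refine IsClosed.inter (isClosed_eq (by fun_prop) ?_) (IsClosed.preimage ?_ ?_)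
    · exact (continuous_fst.mul continuous_const).mul
        (MulOpposite.continuous_unop.comp continuous_snd)
    · exact MulOpposite.continuous_unop.comp continuous_snd
    · exact (isCompact_range (by fun_prop)).isClosed
  have hmul : ∀ r : S × Sᵐᵒᵖ, Continuous (· * r) := fun r => by fun_prop
  obtain ⟨⟨P, Q⟩, ⟨h1, r, h2⟩, h3⟩ := exists_idempotent_in_compact_subsemigroup hmul
    ({ z : S × Sᵐᵒᵖ | x = z.1 * x * z.2.unop } ∩ (fun z => z.2.unop) ⁻¹' Set.range fun r => q * r)
    -- Squares are needed: without an identity element, `q` need not belong to `qS`.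
    ⟨(p * p, MulOpposite.op (q * q)), by
      change x = p * p * x * (q * q)
      calc x = p * x * q := h
        _ = p * (p * x * q) * q := by rw [← h, ← h]
        _ = _ := by simp only [mul_assoc], q, rfl⟩ hcl.isCompact (by
      rintro ⟨P, Q⟩ ⟨h1, r, h2⟩ ⟨P', Q'⟩ ⟨h3, r', h4⟩
      refine ⟨?_, ?_⟩
      · change x = P * P' * x * (Q'.unop * Q.unop)
        calc x = P * x * Q.unop := h1
          _ = P * (P' * x * Q'.unop) * Q.unop := by rw [← h3]
          _ = _ := by simp only [mul_assoc]
      · exact ⟨r' * Q.unop, by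
          change _ = Q'.unop * Q.unop
          change _ = Q'.unop at h4
          rw [← h4, mul_assoc]⟩)
  have hQ : Q.unop * Q.unop = Q.unop := congrArg (fun z : S × Sᵐᵒᵖ => z.2.unop) h3
  change x = P * x * Q.unop at h1
  change q * r = Q.unop at h2
  refine ⟨r, ?_⟩
  rw [mul_assoc, h2]
  calc x = P * x * Q.unop := h1
    _ = P * x * Q.unop * Q.unop := by rw [mul_assoc (P * x), hQ]
    _ = _ := by rw [← h1]

/-- The left half of stability of compact semigroups. -/
theorem exists_eq_mul_left_of_eq_mul_mul {x p q : S} (h : x = p * x * q) :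
    ∃ l, x = l * p * x := by
  obtain ⟨r, hr⟩ := exists_eq_mul_right_of_eq_mul_mul (S := Sᵐᵒᵖ) (x := MulOpposite.op x)
    (p := MulOpposite.op q) (q := MulOpposite.op p) (by
      apply MulOpposite.unop_injective
      simpa [mul_assoc] using h)
  refine ⟨r.unop, ?_⟩
  simpa [mul_assoc] using congrArg MulOpposite.unop hr

/-- An idempotent below another one in the natural order and `J`-above it is equal to it. -/
theorem eq_of_isIdempotentElem_of_eq_mul_mul {f g p q : S} (hg : IsIdempotentElem g)
    (hfg : f * g = g) (hgf : g * f = g) (h : f = p * g * q) : g = f := by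
  obtain ⟨r, hr⟩ := exists_eq_mul_right_of_eq_mul_mul (x := f) (p := p) (q := g * q) (by
    rw [mul_assoc, ← mul_assoc f, hfg, ← mul_assoc, ← h])
  have h1 : f = g * (q * r) := by rw [hr, ← mul_assoc f, hfg, mul_assoc]
  calc g = g * f := hgf.symm
    _ = g * g * (q * r) := by rw [h1, mul_assoc, ← mul_assoc g g, hg.eq]
    _ = f := by rw [hg.eq, ← h1]

/-- `J`-equivalent idempotents of a compact semigroup are conjugate. -/
theorem exists_conjugate_of_isIdempotentElem {e f x y p q : S} (he : IsIdempotentElem e)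
    (hf : IsIdempotentElem f) (h : e = x * f * y) (h' : f = p * e * q) :
    ∃ u v : S, e * u = u ∧ u * f = u ∧ f * v = v ∧ v * e = v ∧ u * v = e ∧ v * u = f := by
  have hu : e * (e * x * f) = e * x * f := by rw [← mul_assoc, ← mul_assoc, he.eq]
  have hv : f * (f * y * e) = f * y * e := by rw [← mul_assoc, ← mul_assoc, hf.eq]
  have hu' : e * x * f * f = e * x * f := by rw [mul_assoc, hf.eq]
  have hv' : f * y * e * e = f * y * e := by rw [mul_assoc, he.eq]
  have huv : e * x * f * (f * y * e) = e := by
    calc e * x * f * (f * y * e) = e * (x * (f * f) * y) * e := by simp only [mul_assoc]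
      _ = e := by rw [hf.eq, ← h, he.eq, he.eq]
  refine ⟨e * x * f, f * y * e, hu, hu', hv, hv', huv, ?_⟩
  generalize e * x * f = u at *
  generalize f * y * e = v at *
  -- The idempotent `vu` is below `f` and `J`-above it, hence equal to `f`.
  have hg : IsIdempotentElem (v * u) := by
    change v * u * (v * u) = v * u
    rw [mul_assoc, ← mul_assoc u, huv, hu]
  refine eq_of_isIdempotentElem_of_eq_mul_mul hg ?_ ?_ (p := p * u) (q := v * q) ?_
  · rw [← mul_assoc, hv]
  · rw [mul_assoc, hu']
  · calc f = p * e * q := h'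
      _ = p * (u * v * (u * v)) * q := by rw [huv, he.eq]
      _ = _ := by simp only [mul_assoc]

end CompactSemigroup

/-! ### Maximal subgroups: conjugation and membership criteria -/

namespace MaximalSubgroup

section Semigroup

variable {S : Type*} [Semigroup S]

/-- Elements with one-sided inverses relative to `e` lie in the maximal subgroup at `e`. -/
theorem exists_inverse {e x r l : S} (he : IsIdempotentElem e) (h1 : e * x = x) (h2 : x * e = x)
    (hr : e = x * r) (hl : e = l * x) :
    e * x = x ∧ x * e = x ∧ ∃ y : S, e * y = y ∧ y * e = y ∧ x * y = e ∧ y * x = e := by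
  have h3 : x * (e * r * e) = e := by
    rw [← mul_assoc, ← mul_assoc, h2, ← hr, he.eq]
  refine ⟨h1, h2, e * r * e, ?_, ?_, h3, ?_⟩
  · rw [← mul_assoc, ← mul_assoc, he.eq]
  · rw [mul_assoc, he.eq]
  · calc e * r * e * x = e * (e * r * e) * x := by rw [← mul_assoc, ← mul_assoc, he.eq]
      _ = l * (x * (e * r * e)) * x := by rw [hl]; simp only [mul_assoc]
      _ = l * (e * x) := by rw [h3, mul_assoc]
      _ = e := by rw [h1, ← hl]

/-- The homomorphism between maximal subgroups at conjugate idempotents. -/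
def conj {e f u v : S} (he : IsIdempotentElem e) (hf : IsIdempotentElem f)
    (hu' : u * f = u) (hv : f * v = v) (hv' : v * e = v) (huv : u * v = e) (hvu : v * u = f) :
    MaximalSubgroup e he →* MaximalSubgroup f hf where
  toFun g := ⟨v * g.1 * u, by
    obtain ⟨g, h1, h2, g', h3, h4, h5, h6⟩ := g
    refine ⟨by simp only [← mul_assoc, hv], by simp only [mul_assoc, hu'], v * g' * u,
      by simp only [← mul_assoc, hv], by simp only [mul_assoc, hu'], ?_, ?_⟩
    · calc v * g * u * (v * g' * u) = v * (g * (u * v) * g') * u := by simp only [mul_assoc]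
        _ = f := by rw [huv, h2, h5, hv', hvu]
    · calc v * g' * u * (v * g * u) = v * (g' * (u * v) * g) * u := by simp only [mul_assoc]
        _ = f := by rw [huv, h4, h6, hv', hvu]⟩
  map_one' := ext (by change v * e * u = f; rw [hv', hvu])
  map_mul' g h := ext (by
    change v * (g.1 * h.1) * u = v * g.1 * u * (v * h.1 * u)
    calc v * (g.1 * h.1) * u = v * (g.1 * e * h.1) * u := by rw [g.2.2.1]
      _ = v * (g.1 * (u * v) * h.1) * u := by
        exact congrArg (fun z => v * (g.1 * z * h.1) * u) huv.symm
      _ = _ := by simp only [mul_assoc])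

/-- Maximal subgroups at conjugate idempotents are isomorphic as topological groups. -/
theorem exists_continuousMulEquiv [TopologicalSpace S] [ContinuousMul S] {e f u v : S}
    (he : IsIdempotentElem e) (hf : IsIdempotentElem f) (hu : e * u = u)
    (hu' : u * f = u) (hv : f * v = v) (hv' : v * e = v) (huv : u * v = e) (hvu : v * u = f) :
    Nonempty (MaximalSubgroup e he ≃ₜ* MaximalSubgroup f hf) :=
  ⟨{ conj he hf hu' hv hv' huv hvu with
      invFun := conj hf he hv' hu hu' hvu huv
      left_inv := fun g => ext (by
        change u * (v * g.1 * u) * v = g.1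
        calc u * (v * g.1 * u) * v = (u * v) * g.1 * (u * v) := by simp only [mul_assoc]
          _ = g.1 := by rw [huv, g.2.1, g.2.2.1])
      right_inv := fun g => ext (by
        change v * (u * g.1 * v) * u = g.1
        calc v * (u * g.1 * v) * u = (v * u) * g.1 * (v * u) := by simp only [mul_assoc]
          _ = g.1 := by rw [hvu, g.2.1, g.2.2.1])
      continuous_toFun := Continuous.subtype_mk
        ((continuous_const.mul continuous_val).mul continuous_const) _
      continuous_invFun := Continuous.subtype_mk
        ((continuous_const.mul continuous_val).mul continuous_const) _ }⟩

end Semigroup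

/-- In a compact semigroup, elements `x`, `y` with the given divisibility relations lie in a
common maximal subgroup. -/
theorem exists_idempotent_of_factorizations {S : Type*} [Semigroup S] [TopologicalSpace S]
    [ContinuousMul S] [CompactSpace S] [T2Space S] {x y r s t : S}
    (h1 : x = x * y * (x * x) * r) (h2 : x = s * y) (h3 : y = x * t) :
    ∃ e : S, IsIdempotentElem e ∧
      (e * x = x ∧ x * e = x ∧ ∃ z : S, e * z = z ∧ z * e = z ∧ x * z = e ∧ z * x = e) ∧
      (e * y = y ∧ y * e = y ∧ ∃ z : S, e * z = z ∧ z * e = z ∧ y * z = e ∧ z * y = e) := by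
  obtain ⟨p, hp⟩ := exists_eq_mul_right_of_eq_mul_mul (x := x) (p := x * y) (q := x * r)
    (h1.trans (by simp only [mul_assoc]))
  obtain ⟨l, hl⟩ := exists_eq_mul_left_of_eq_mul_mul (x := x) (p := x * y * x) (q := r)
    (h1.trans (by simp only [mul_assoc]))
  obtain ⟨p', hp'⟩ := exists_eq_mul_right_of_eq_mul_mul (x := x) (p := x)
    (q := t * (x * x) * r) (h1.trans (by rw [h3]; simp only [mul_assoc]))
  obtain ⟨l', hl'⟩ := exists_eq_mul_left_of_eq_mul_mul (x := y) (p := x * y * x * s)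
    (q := r * t) (by
      calc y = x * y * (x * x) * r * t := by rw [← h1, ← h3]
        _ = x * y * x * (s * y) * (r * t) := by rw [← h2]; simp only [mul_assoc]
        _ = _ := by simp only [mul_assoc])
  -- By stability `x` is both `R`- and `L`-equivalent to `x²`, so it lies in a subgroup whose
  -- identity is `xP = Qx`.
  have hP : x = x * x * (r * p) := hp.trans (by simp only [mul_assoc])
  have hQ : x = l * x * y * x * x := hl.trans (by simp only [mul_assoc])
  generalize r * p = P at hP
  generalize l * x * y = Q at hQ
  -- Together with `h2` and `h3`, these make `y` both `R`- and `L`-equivalent to `x`, so `y` lies in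
  -- the same subgroup.
  have hy1 : x = y * (x * x * r * p') := hp'.trans (by rw [h3]; simp only [mul_assoc])
  have hy2 : y = l' * (x * y * x) * x := by
    calc y = l' * (x * y * x) * (s * y) := hl'.trans (by simp only [mul_assoc])
      _ = _ := by rw [← h2]
  have he : Q * x = x * P := by
    calc Q * x = Q * (x * x * P) := by rw [← hP]
      _ = Q * x * x * P := by simp only [mul_assoc]
      _ = x * P := by rw [← hQ]
  have hx1 : x * P * x = x := by rw [← he, ← hQ]
  have hx2 : x * (x * P) = x := by rw [← mul_assoc, ← hP]
  have hid : IsIdempotentElem (x * P) := by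
    change x * P * (x * P) = x * P
    rw [← mul_assoc, hx1]
  refine ⟨x * P, hid, exists_inverse hid hx1 hx2 rfl he.symm,
    exists_inverse hid (r := x * x * r * p' * P) (l := Q * s) ?_ ?_ ?_ ?_⟩
  · rw [h3, ← mul_assoc, hx1]
  · rw [hy2, mul_assoc _ x, hx2]
  · rw [← mul_assoc, ← hy1]
  · rw [mul_assoc, ← h2, he]

end MaximalSubgroup

/-! ### Words as nonempty lists -/

namespace FreeSemigroup

variable {A : Type}

/-- The list of letters of a word. -/
def letters (w : FreeSemigroup A) : List A := w.head :: w.tail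

theorem letters_mul (u v : FreeSemigroup A) : (u * v).letters = u.letters ++ v.letters := rfl

theorem letters_of (x : A) : (of x).letters = [x] := rfl

theorem letters_ne_nil (u : FreeSemigroup A) : u.letters ≠ [] := List.cons_ne_nil _ _

theorem letters_injective : Function.Injective (letters (A := A)) := by
  intro u v h
  exact FreeSemigroup.ext (List.cons.inj h).1 (List.cons.inj h).2

theorem exists_letters_eq {l : List A} (h : l ≠ []) : ∃ w : FreeSemigroup A, w.letters = l := by
  obtain ⟨x, t, rfl⟩ := List.exists_cons_of_ne_nil h
  exact ⟨⟨x, t⟩, rfl⟩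

/-- Equidivisibility of the free semigroup. Coinciding cuts form a separate case because there is no
empty word. -/
theorem mul_eq_mul {u v x y : FreeSemigroup A} (h : u * v = x * y) :
    (u = x ∧ v = y) ∨ (∃ z, u = x * z ∧ y = z * v) ∨ ∃ z, x = u * z ∧ v = z * y := by
  have h1 := congrArg letters h
  rw [letters_mul, letters_mul, List.append_eq_append_iff] at h1
  rcases h1 with ⟨t, h1, h2⟩ | ⟨t, h1, h2⟩
  · rcases eq_or_ne t [] with rfl | ht
    · left
      exact ⟨letters_injective (by simpa using h1.symm), letters_injective (by simpa using h2)⟩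
    · obtain ⟨z, rfl⟩ := exists_letters_eq ht
      exact .inr (.inr ⟨z, letters_injective h1, letters_injective h2⟩)
  · rcases eq_or_ne t [] with rfl | ht
    · left
      exact ⟨letters_injective (by simpa using h1), letters_injective (by simpa using h2.symm)⟩
    · obtain ⟨z, rfl⟩ := exists_letters_eq ht
      exact .inr (.inl ⟨z, letters_injective h1, letters_injective h2⟩)

theorem isFactor_iff {u v : FreeSemigroup A} : IsFactor u v ↔ u.letters <:+: v.letters := by
  constructor
  · rintro ⟨x, y, h⟩
    cases x with
    | one =>
      cases y with
      | one =>
        rw [one_mul, mul_one, WithOne.coe_inj] at h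
        rw [h]
      | coe y =>
        rw [one_mul, ← WithOne.coe_mul, WithOne.coe_inj] at h
        exact ⟨[], y.letters, by rw [h]; rfl⟩
    | coe x =>
      cases y with
      | one =>
        rw [mul_one, ← WithOne.coe_mul, WithOne.coe_inj] at h
        exact ⟨x.letters, [], by rw [h, List.append_nil]; rfl⟩
      | coe y =>
        rw [← WithOne.coe_mul, ← WithOne.coe_mul, WithOne.coe_inj] at h
        exact ⟨x.letters, y.letters, by rw [h]; rfl⟩
  · rintro ⟨s, t, h⟩
    have key : ∀ l : List A, ∃ x : WithOne (FreeSemigroup A), ∀ w : FreeSemigroup A,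
        (∃ w' : FreeSemigroup A, x * w = w' ∧ w'.letters = l ++ w.letters) ∧
        ∃ w' : FreeSemigroup A, w * x = w' ∧ w'.letters = w.letters ++ l := by
      intro l
      rcases eq_or_ne l [] with rfl | hl
      · exact ⟨1, fun w => ⟨⟨w, one_mul _, rfl⟩, w, mul_one _, (List.append_nil _).symm⟩⟩
      · obtain ⟨x, rfl⟩ := exists_letters_eq hl
        exact ⟨x, fun w => ⟨⟨x * w, rfl, rfl⟩, w * x, rfl, rfl⟩⟩
    obtain ⟨x, hx⟩ := key s
    obtain ⟨y, hy⟩ := key t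
    obtain ⟨w, hw, hw'⟩ := (hx u).1
    obtain ⟨w', hw1, hw1'⟩ := (hy w).2
    refine ⟨x, y, ?_⟩
    rw [hw, hw1, letters_injective (h.symm.trans (by rw [hw1', hw']))]

end FreeSemigroup

/-! ### Finite index congruences and the topology of the free profinite semigroup -/

namespace FiniteIndexCon

variable {A : Type}

/-- The kernel congruence of a map to a finite set, compatible with products. -/
def ofFinite {X : Type*} (f : FreeSemigroup A → X) (hf : (Set.range f).Finite)
    (h : ∀ u u' v v', f u = f u' → f v = f v' → f (u * v) = f (u' * v')) : FiniteIndexCon A :=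
  ⟨{ r := fun u v => f u = f v
     iseqv := ⟨fun _ => rfl, Eq.symm, Eq.trans⟩
     mul' := fun h1 h2 => h _ _ _ _ h1 h2 }, by
    have := hf.to_subtype
    refine Finite.of_injective (β := Set.range f)
      (Quotient.lift (fun u => ⟨f u, u, rfl⟩) fun u v huv => Subtype.ext huv) ?_
    intro u v
    refine Quotient.inductionOn₂ u v fun u v huv => Quotient.sound ?_
    exact congrArg Subtype.val huv⟩

/-- The class of a word. -/
def mk (c : FiniteIndexCon A) (w : FreeSemigroup A) : FinQuot c := (w : c.1.Quotient)

theorem mk_mul (c : FiniteIndexCon A) (u v : FreeSemigroup A) :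
    c.mk (u * v) = c.mk u * c.mk v := rfl

theorem mk_eq_iff {c : FiniteIndexCon A} {u v : FreeSemigroup A} :
    c.mk u = c.mk v ↔ c.1 u v := c.1.eq

theorem mk_ofFinite_eq_iff {X : Type*} {f : FreeSemigroup A → X} {hf : (Set.range f).Finite}
    {h : ∀ u u' v v', f u = f u' → f v = f v' → f (u * v) = f (u' * v')}
    {u v : FreeSemigroup A} : (ofFinite f hf h).mk u = (ofFinite f hf h).mk v ↔ f u = f v :=
  mk_eq_iff

theorem mk_surjective (c : FiniteIndexCon A) : Function.Surjective c.mk :=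
  Quotient.exists_rep

/-- Common refinement of two finite index congruences. -/
def inf (c d : FiniteIndexCon A) : FiniteIndexCon A :=
  ofFinite (fun u => (c.mk u, d.mk u)) (Set.toFinite _) fun u u' v v' h1 h2 => by
    simp only [Prod.mk.injEq] at h1 h2 ⊢
    rw [mk_mul, mk_mul, mk_mul, mk_mul, h1.1, h1.2, h2.1, h2.2]
    exact ⟨rfl, rfl⟩

theorem mk_inf_eq_iff {c d : FiniteIndexCon A} {u v : FreeSemigroup A} :
    (c.inf d).mk u = (c.inf d).mk v ↔ c.mk u = c.mk v ∧ d.mk u = d.mk v := by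
  unfold inf
  rw [mk_ofFinite_eq_iff, Prod.mk.injEq]

/-- The congruence identifying the words with the same prefix of length `m`. -/
def prefixes [Finite A] (m : ℕ) : FiniteIndexCon A :=
  ofFinite (fun w => w.letters.take m)
    ((List.finite_length_le A m).subset (by
      rintro _ ⟨w, rfl⟩
      simp [List.length_take]))
    (fun u u' v v' h1 h2 => by
      have key : ∀ u v : FreeSemigroup A, (u * v).letters.take m =
          (u.letters.take m ++ v.letters.take m).take m := by
        intro u v
        rw [FreeSemigroup.letters_mul, List.take_append, List.take_append, List.take_take,
          List.take_take, List.length_take]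
        congr 2 <;> omega
      change _ = _ at h1 h2 ⊢
      rw [key, key, h1, h2])

theorem take_eq_of_mk_prefixes_eq [Finite A] {m : ℕ} {u v : FreeSemigroup A}
    (h : (prefixes m).mk u = (prefixes m).mk v) : u.letters.take m = v.letters.take m :=
  mk_ofFinite_eq_iff.mp h

/-- The strict bound matters: a truncation to `m` letters that has fewer than `m` letters is the
whole word. -/
theorem eq_of_mk_prefixes_eq [Finite A] {m : ℕ} {u v : FreeSemigroup A}
    (h : (prefixes m).mk u = (prefixes m).mk v) (hu : u.letters.length < m) : u = v := by
  have h1 := take_eq_of_mk_prefixes_eq h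
  rw [List.take_of_length_le hu.le] at h1
  have h2 := congrArg List.length h1
  rw [List.length_take] at h2
  rw [List.take_of_length_le (by omega)] at h1
  exact FreeSemigroup.letters_injective h1

theorem prefix_of_mk_prefixes_eq [Finite A] {m : ℕ} {q u v : FreeSemigroup A}
    (h : (prefixes m).mk u = (prefixes m).mk v) (hq : q.letters.length = m)
    (hv : q.letters <+: v.letters) : q.letters <+: u.letters := by
  rw [List.prefix_iff_eq_take, hq] at hv
  rw [hv, ← take_eq_of_mk_prefixes_eq h]
  exact List.take_prefix _ _

/-- Basic open sets of the product constrain finitely many coordinates; this replaces them by a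
single one. -/
theorem exists_refinement {I : Set (FiniteIndexCon A)} (hI : I.Finite) :
    ∃ d : FiniteIndexCon A, ∀ c ∈ I, ∀ u v, d.mk u = d.mk v → c.mk u = c.mk v := by
  induction I, hI using Set.Finite.induction_on with
  | empty =>
    exact ⟨ofFinite (fun _ => ()) (Set.toFinite _) fun _ _ _ _ _ _ => rfl, by simp⟩
  | @insert c J _ _ ih =>
    obtain ⟨d, hd⟩ := ih
    refine ⟨c.inf d, ?_⟩
    rintro c' (rfl | hc) u v huv
    · exact (mk_inf_eq_iff.mp huv).1
    · exact hd c' hc u v (mk_inf_eq_iff.mp huv).2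

/-- A congruence whose classes determine the pairs of classes of the factors in all
factorizations of a word into two factors. -/
def factor (c : FiniteIndexCon A) : FiniteIndexCon A :=
  ofFinite (X := FinQuot c × Set (FinQuot c × FinQuot c))
    (fun w => (c.mk w, { p | ∃ u v, w = u * v ∧ c.mk u = p.1 ∧ c.mk v = p.2 }))
    (Set.toFinite _) (by
      -- A cut of `uv` falls inside `u`, between `u` and `v`, or inside `v`; each can be reproduced,
      -- up to `c`, in `u'v'`.
      have key : ∀ u u' v v' : FreeSemigroup A, c.mk u = c.mk u' → c.mk v = c.mk v' →
          { p : FinQuot c × FinQuot c | ∃ x y, u = x * y ∧ c.mk x = p.1 ∧ c.mk y = p.2 } ⊆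
          { p | ∃ x y, u' = x * y ∧ c.mk x = p.1 ∧ c.mk y = p.2 } →
          { p : FinQuot c × FinQuot c | ∃ x y, v = x * y ∧ c.mk x = p.1 ∧ c.mk y = p.2 } ⊆
          { p | ∃ x y, v' = x * y ∧ c.mk x = p.1 ∧ c.mk y = p.2 } →
          { p : FinQuot c × FinQuot c | ∃ x y, u * v = x * y ∧ c.mk x = p.1 ∧ c.mk y = p.2 } ⊆
          { p | ∃ x y, u' * v' = x * y ∧ c.mk x = p.1 ∧ c.mk y = p.2 } := by
        rintro u u' v v' hu hv hu' hv' ⟨s, t⟩ ⟨x, y, hxy, rfl, rfl⟩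
        rcases FreeSemigroup.mul_eq_mul hxy with ⟨rfl, rfl⟩ | ⟨z, rfl, rfl⟩ | ⟨z, rfl, rfl⟩
        · exact ⟨u', v', rfl, hu.symm, hv.symm⟩
        · obtain ⟨x', z', rfl, h1, h2⟩ := hu' (a := (c.mk x, c.mk z)) ⟨x, z, rfl, rfl, rfl⟩
          exact ⟨x', z' * v', mul_assoc _ _ _, h1, by rw [mk_mul, mk_mul, h2, hv]⟩
        · obtain ⟨z', y', rfl, h1, h2⟩ := hv' (a := (c.mk z, c.mk y)) ⟨z, y, rfl, rfl, rfl⟩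
          exact ⟨u' * z', y', (mul_assoc _ _ _).symm, by rw [mk_mul, mk_mul, h1, hu], h2⟩
      intro u u' v v' h1 h2
      rw [Prod.mk.injEq] at h1 h2 ⊢
      exact ⟨by rw [mk_mul, mk_mul, h1.1, h2.1],
        (key _ _ _ _ h1.1 h2.1 h1.2.subset h2.2.subset).antisymm
          (key _ _ _ _ h1.1.symm h2.1.symm h1.2.superset h2.2.superset)⟩)

theorem exists_factorization_of_mk_factor_eq {c : FiniteIndexCon A} {w u v : FreeSemigroup A}
    (h : c.factor.mk w = c.factor.mk (u * v)) :
    ∃ u' v', w = u' * v' ∧ c.mk u' = c.mk u ∧ c.mk v' = c.mk v := by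
  unfold factor at h
  rw [mk_ofFinite_eq_iff, Prod.mk.injEq] at h
  have h2 : (c.mk u, c.mk v) ∈ { p : FinQuot c × FinQuot c |
      ∃ x y, u * v = x * y ∧ c.mk x = p.1 ∧ c.mk y = p.2 } := ⟨u, v, rfl, rfl, rfl⟩
  rw [← h.2] at h2
  exact h2

end FiniteIndexCon

/-! ### Projections and closures in the free profinite semigroup -/

namespace FreeProfiniteSemigroup

variable {A : Type}

/-- The canonical projection to a finite quotient. -/
def proj (c : FiniteIndexCon A) : FreeProfiniteSemigroup A →ₙ* FinQuot c where
  toFun x := x.1 c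
  map_mul' _ _ := rfl

theorem continuous_proj (c : FiniteIndexCon A) : Continuous (proj c) :=
  (continuous_apply c).comp continuous_subtype_val

theorem proj_wordToProfinite (c : FiniteIndexCon A) (w : FreeSemigroup A) :
    proj c (wordToProfinite A w) = c.mk w := rfl

theorem tendsto_iff_eventually {α : Type*} {l : Filter α} {f : α → FreeProfiniteSemigroup A}
    {x : FreeProfiniteSemigroup A} :
    Tendsto f l (𝓝 x) ↔ ∀ c, ∀ᶠ i in l, proj c (f i) = proj c x := by
  rw [tendsto_subtype_rng, tendsto_pi_nhds]
  refine forall_congr' fun c => ?_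
  rw [nhds_discrete, tendsto_pure]
  rfl

theorem denseRange_wordToProfinite : DenseRange (wordToProfinite A) := by
  intro x
  rw [closure_subtype]
  have h := x.2
  change x.1 ∈ closure ((toProd A).srange : Set _) at h
  convert h using 2
  ext y
  constructor
  · rintro ⟨_, ⟨w, rfl⟩, rfl⟩
    exact ⟨w, rfl⟩
  · rintro ⟨w, rfl⟩
    exact ⟨_, ⟨w, rfl⟩, rfl⟩

theorem exists_word (x : FreeProfiniteSemigroup A) (c d : FiniteIndexCon A) :
    ∃ w, proj c x = c.mk w ∧ proj d x = d.mk w := by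
  have h1 : IsOpen { y : FreeProfiniteSemigroup A | proj c y = proj c x ∧ proj d y = proj d x } :=
    ((isOpen_discrete {proj c x}).preimage (continuous_proj c)).inter
      ((isOpen_discrete {proj d x}).preimage (continuous_proj d))
  obtain ⟨w, hw⟩ := denseRange_wordToProfinite.exists_mem_open h1 ⟨x, rfl, rfl⟩
  exact ⟨w, hw.1.symm, hw.2.symm⟩

/-- The coordinates of `x` are as coherent as those of a word, since some word agrees with `x` in
both. -/
theorem proj_eq_of_proj_eq {x : FreeProfiniteSemigroup A} {c d : FiniteIndexCon A}
    {w : FreeSemigroup A} (h : proj c x = c.mk w)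
    (hcd : ∀ v, c.mk v = c.mk w → d.mk v = d.mk w) : proj d x = d.mk w := by
  obtain ⟨v, h1, h2⟩ := exists_word x c d
  rw [h2]
  exact hcd v (h1.symm.trans h)

/-- Finite index congruences are directed under refinement, so the fibres of single projections form
a neighbourhood base. -/
theorem mem_closure_iff_proj {Z : Set (FreeProfiniteSemigroup A)} {x : FreeProfiniteSemigroup A} :
    x ∈ closure Z ↔ ∀ c, ∃ z ∈ Z, proj c z = proj c x := by
  constructor
  · intro h c
    have h1 : IsOpen { y : FreeProfiniteSemigroup A | proj c y = proj c x } :=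
      (isOpen_discrete {proj c x}).preimage (continuous_proj c)
    obtain ⟨z, h2, hz⟩ := _root_.mem_closure_iff.mp h _ h1 rfl
    exact ⟨z, hz, h2⟩
  · intro h
    rw [closure_subtype, _root_.mem_closure_iff_nhds]
    intro t ht
    rw [nhds_pi, Filter.mem_pi] at ht
    obtain ⟨I, hI, s, hs, hst⟩ := ht
    obtain ⟨d, hd⟩ := FiniteIndexCon.exists_refinement hI
    obtain ⟨z, hz, hzd⟩ := h d
    obtain ⟨w, hw⟩ := d.mk_surjective (proj d x)
    refine ⟨z.1, hst ?_, _, hz, rfl⟩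
    intro c hc
    have h1 : proj c x = c.mk w := proj_eq_of_proj_eq hw.symm fun v hv => hd c hc v w hv
    have h2 : proj c z = c.mk w :=
      proj_eq_of_proj_eq (hzd.trans hw.symm) fun v hv => hd c hc v w hv
    have h3 := mem_of_mem_nhds (hs c)
    change proj c z ∈ s c
    rw [h2, ← h1]
    exact h3

theorem mem_closure_iff {Z : Set (FreeSemigroup A)} {x : FreeProfiniteSemigroup A} :
    x ∈ closure (wordToProfinite A '' Z) ↔ ∀ c, ∃ w ∈ Z, proj c x = c.mk w := by
  simp only [mem_closure_iff_proj, Set.exists_mem_image, proj_wordToProfinite, eq_comm]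

/-- Openness of the multiplication, restricted to the closure of a language. -/
theorem exists_mul_mem_of_mul_mem_closure {Z : Set (FreeSemigroup A)}
    {x y : FreeProfiniteSemigroup A} (h : x * y ∈ closure (wordToProfinite A '' Z))
    (c : FiniteIndexCon A) : ∃ u v, u * v ∈ Z ∧ proj c x = c.mk u ∧ proj c y = c.mk v := by
  -- A word of `Z` close to `xy` for `c.factor` can be cut into two words close to `x` and `y` for
  -- `c`.
  obtain ⟨w, hw, h1⟩ := mem_closure_iff.mp h c.factor
  obtain ⟨u, hu, hu'⟩ := exists_word x c.factor c
  obtain ⟨v, hv, hv'⟩ := exists_word y c.factor c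
  rw [map_mul, hu, hv, ← FiniteIndexCon.mk_mul] at h1
  obtain ⟨u', v', rfl, h2, h3⟩ := FiniteIndexCon.exists_factorization_of_mk_factor_eq h1.symm
  exact ⟨u', v', hw, hu'.trans h2.symm, hv'.trans h3.symm⟩

/-- A homomorphism to a finite discrete semigroup extends to the free profinite semigroup. -/
theorem exists_extension {M : Type*} [Semigroup M] [Finite M] [TopologicalSpace M]
    (f : FreeSemigroup A →ₙ* M) :
    ∃ F : FreeProfiniteSemigroup A →ₙ* M, Continuous F ∧ ∀ w, F (wordToProfinite A w) = f w := by
  let c : FiniteIndexCon A := FiniteIndexCon.ofFinite (fun w => f w) (Set.toFinite _)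
    fun u u' v v' h1 h2 => by rw [map_mul, map_mul, h1, h2]
  let g : FinQuot c → M := Quotient.lift (fun w => f w) fun _ _ h => h
  have hg : ∀ w, g (c.mk w) = f w := fun _ => rfl
  refine ⟨⟨fun x => g (proj c x), fun x y => ?_⟩,
    (continuous_of_discreteTopology (f := g)).comp (continuous_proj c), fun _ => rfl⟩
  obtain ⟨u, hu⟩ := c.mk_surjective (proj c x)
  obtain ⟨v, hv⟩ := c.mk_surjective (proj c y)
  rw [map_mul, ← hu, ← hv, ← FiniteIndexCon.mk_mul, hg, hg, hg, map_mul]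

end FreeProfiniteSemigroup

/-! ### The idempotent power of a substitution -/

section OmegaPower

variable {A : Type} [Finite A] (φ : FreeSemigroup A →ₙ* FreeSemigroup A)

/-- Modulo `c`, an iterate is determined by the classes of the images of the finitely many letters,
so two iterates `φⁱ` and `φʲ` agree. They are applied after the other iterates, so `c` need not be
compatible with `φ`. -/
theorem exists_iterate_period (c : FiniteIndexCon A) : ∃ d > 0, ∀ k j, 0 < k → 0 < j →
    d ∣ k → d ∣ j → ∀ w, c.mk (φ^[k] w) = c.mk (φ^[j] w) := by
  have hfin : Finite (FinQuot c) := inferInstance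
  obtain ⟨i, j, hij, h⟩ : ∃ i j : ℕ, i < j ∧
      (fun x : A => c.mk (φ^[i] (FreeSemigroup.of x))) =
        fun x : A => c.mk (φ^[j] (FreeSemigroup.of x)) := by
    obtain ⟨i, j, hij, h⟩ := Finite.exists_ne_map_eq_of_infinite
      fun (n : ℕ) (x : A) => c.mk (φ^[n] (FreeSemigroup.of x))
    rcases hij.lt_or_gt with h1 | h1
    · exact ⟨i, j, h1, h⟩
    · exact ⟨j, i, h1, h.symm⟩
  have hw : ∀ w, c.mk (φ^[i] w) = c.mk (φ^[j] w) := by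
    intro w
    induction w with
    | ih1 x => exact congrFun h x
    | ih2 x y hx hy =>
      rw [iterate_map_mul, iterate_map_mul, FiniteIndexCon.mk_mul, FiniteIndexCon.mk_mul, hx, hy]
  have hp : ∀ t n, i ≤ t → ∀ w, c.mk (φ^[t + (j - i) * n] w) = c.mk (φ^[t] w) := by
    intro t n ht w
    induction n with
    | zero => rfl
    | succ n ih =>
      rw [← ih, show t + (j - i) * (n + 1) = j + (t - i + (j - i) * n) by
        rw [mul_add]; omega, show t + (j - i) * n = i + (t - i + (j - i) * n) by omega,
        Function.iterate_add_apply φ j, Function.iterate_add_apply φ i, hw]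
  have hq : ∀ n w, c.mk (φ^[(j - i) * (i + 1) * (n + 1)] w) =
      c.mk (φ^[(j - i) * (i + 1)] w) := by
    intro n w
    rw [show (j - i) * (i + 1) * (n + 1) =
      (j - i) * (i + 1) + (j - i) * ((i + 1) * n) by ring, hp]
    nlinarith [Nat.sub_pos_of_lt hij]
  -- The factor `i + 1` makes this multiple of the period exceed the preperiod `i`.
  refine ⟨(j - i) * (i + 1), Nat.mul_pos (Nat.sub_pos_of_lt hij) i.succ_pos, ?_⟩
  rintro k l hk hl ⟨k, rfl⟩ ⟨l, rfl⟩ w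
  obtain ⟨k, rfl⟩ := Nat.exists_eq_succ_of_ne_zero (Nat.pos_of_mul_pos_left hk).ne'
  obtain ⟨l, rfl⟩ := Nat.exists_eq_succ_of_ne_zero (Nat.pos_of_mul_pos_left hl).ne'
  rw [hq, hq]

theorem exists_tendsto_iterate_factorial (w : FreeSemigroup A) :
    ∃ x, Tendsto (fun n : ℕ => wordToProfinite A (φ^[n.factorial] w)) atTop (𝓝 x) := by
  choose d hd hd' using exists_iterate_period φ
  have h : Tendsto (fun n : ℕ => toProd A (φ^[n.factorial] w)) atTop
      (𝓝 fun c => c.mk (φ^[d c] w)) := by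
    rw [tendsto_pi_nhds]
    intro c
    refine tendsto_const_nhds.congr' ?_
    filter_upwards [eventually_ge_atTop (d c)] with n hn
    exact hd' c _ _ (hd c) n.factorial_pos dvd_rfl (Nat.dvd_factorial (hd c) hn) w
  refine ⟨⟨_, mem_closure_of_tendsto h (Eventually.of_forall fun n => ⟨_, rfl⟩)⟩, ?_⟩
  rw [tendsto_subtype_rng]
  exact h

/-- The idempotent power `φ^ω` of a substitution, as a map to the free profinite semigroup. -/
noncomputable def omegaPower : FreeSemigroup A →ₙ* FreeProfiniteSemigroup A where
  toFun w := (exists_tendsto_iterate_factorial φ w).choose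
  map_mul' u v := by
    refine tendsto_nhds_unique (exists_tendsto_iterate_factorial φ (u * v)).choose_spec ?_
    refine ((exists_tendsto_iterate_factorial φ u).choose_spec.mul
      (exists_tendsto_iterate_factorial φ v).choose_spec).congr fun n => ?_
    rw [iterate_map_mul, map_mul]

theorem tendsto_omegaPower (w : FreeSemigroup A) :
    Tendsto (fun n : ℕ => wordToProfinite A (φ^[n.factorial] w)) atTop (𝓝 (omegaPower φ w)) :=
  (exists_tendsto_iterate_factorial φ w).choose_spec

/-- Modulo a fixed congruence `φ^ω` is an actual iterate, so combinatorics of words applies to it.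
-/
theorem exists_proj_omegaPower (c : FiniteIndexCon A) : ∃ d > 0, ∀ k, 0 < k → d ∣ k → ∀ w,
    FreeProfiniteSemigroup.proj c (omegaPower φ w) = c.mk (φ^[k] w) := by
  obtain ⟨d, hd, h⟩ := exists_iterate_period φ c
  refine ⟨d, hd, fun k hk hdk w => ?_⟩
  obtain ⟨n, hn, hn'⟩ := ((FreeProfiniteSemigroup.tendsto_iff_eventually.mp
    (tendsto_omegaPower φ w) c).and (eventually_ge_atTop d)).exists
  rw [← hn, FreeProfiniteSemigroup.proj_wordToProfinite]
  exact h _ _ n.factorial_pos hk (Nat.dvd_factorial hd hn') hdk w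

/-- Idempotency of `φ^ω`, phrased without extending `φ` to profinite words. In each coordinate `d`
and `d`-divisible sums of factorials give the same iterate. -/
theorem tendsto_omegaPower_iterate (w : FreeSemigroup A) :
    Tendsto (fun n : ℕ => omegaPower φ (φ^[n.factorial] w)) atTop (𝓝 (omegaPower φ w)) := by
  rw [FreeProfiniteSemigroup.tendsto_iff_eventually]
  intro c
  obtain ⟨d, hd, h⟩ := exists_proj_omegaPower φ c
  filter_upwards [eventually_ge_atTop d] with n hn
  rw [h d hd dvd_rfl w, h _ n.factorial_pos (Nat.dvd_factorial hd hn),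
    ← Function.iterate_add_apply, ← h d hd dvd_rfl w,
    h _ (by have := n.factorial_pos; omega)
      ((Nat.dvd_factorial hd hn).add (Nat.dvd_factorial hd hn))]

end OmegaPower

/-! ### The substitution `a ↦ ab`, `b ↦ aaab` -/

namespace Letter

instance : Finite Letter := Finite.of_injective (fun x => match x with | a => true | b => false)
  fun x y h => by cases x <;> cases y <;> simp_all

/-- The action of the substitution on lists of letters. -/
def subst (l : List Letter) : List Letter :=
  l.flatMap fun x => match x with
    | a => [a, b]
    | b => [a, a, a, b]

theorem letters_phi (w : FreeSemigroup Letter) : (phi w).letters = subst w.letters := by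
  induction w with
  | ih1 x => cases x <;> rfl
  | ih2 x y hx hy =>
    rw [map_mul, FreeSemigroup.letters_mul, hx, hy, FreeSemigroup.letters_mul, subst, subst, subst,
      List.flatMap_append]

theorem letters_phi_iterate (n : ℕ) (w : FreeSemigroup Letter) :
    (phi^[n] w).letters = subst^[n] w.letters := by
  induction n generalizing w with
  | zero => rfl
  | succ n ih => rw [Function.iterate_succ_apply, Function.iterate_succ_apply, ih, letters_phi]

theorem subst_append (l m : List Letter) : subst (l ++ m) = subst l ++ subst m :=
  List.flatMap_append

theorem subst_nil : subst [] = [] := rfl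

theorem subst_cons_a (l : List Letter) : subst (a :: l) = a :: b :: subst l := rfl

theorem subst_cons_b (l : List Letter) : subst (b :: l) = a :: a :: a :: b :: subst l := rfl

theorem subst_iterate_append (n : ℕ) (l m : List Letter) :
    subst^[n] (l ++ m) = subst^[n] l ++ subst^[n] m := by
  induction n generalizing l m with
  | zero => rfl
  | succ n ih => simp only [Function.iterate_succ_apply, subst_append, ih]

theorem subst_iterate_nil (n : ℕ) : subst^[n] [] = [] := by
  induction n with
  | zero => rfl
  | succ n ih => rw [Function.iterate_succ_apply, subst_nil, ih]

/-! ### Desubstitution and recognizability -/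

theorem subst_injective : Function.Injective subst := by
  intro l
  induction l with
  | nil =>
    intro m h
    rcases m with _ | ⟨_ | _, m⟩
    · rfl
    · cases h
    · cases h
  | cons x l ih =>
    intro m h
    rcases m with _ | ⟨y, m⟩
    · cases x <;> cases h
    · cases x <;> cases y <;> simp only [subst_cons_a, subst_cons_b, List.cons.injEq, reduceCtorEq,
        true_and, false_and] at h
      · rw [ih h]
      · rw [ih h]

theorem subst_iterate_injective (n : ℕ) : Function.Injective subst^[n] :=
  subst_injective.iterate n

/-- A cut of an image just after a letter `b` comes from a cut of the preimage. -/
theorem exists_append_of_append_eq_subst {v x y : List Letter} (h : x ++ y = subst v)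
    (hx : x = [] ∨ ∃ x', x = x' ++ [b]) :
    ∃ v₁ v₂, v = v₁ ++ v₂ ∧ subst v₁ = x ∧ subst v₂ = y := by
  rcases hx with rfl | ⟨x, rfl⟩
  · exact ⟨[], v, rfl, rfl, h.symm⟩
  -- In `ab` and `aaab` the letter `b` occurs only at the end, so each `b` of an image closes a
  -- block.
  · induction v generalizing x with
    | nil => simp [subst_nil] at h
    | cons z v ih =>
      have key : ∀ x', x' ++ [b] ++ y = subst v → subst [z] ++ x' = x →
          ∃ v₁ v₂, z :: v = v₁ ++ v₂ ∧ subst v₁ = x ++ [b] ∧ subst v₂ = y := by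
        intro x' h1 h2
        obtain ⟨v₁, v₂, rfl, h3, h4⟩ := ih x' h1
        refine ⟨z :: v₁, v₂, rfl, ?_, h4⟩
        rw [← List.singleton_append, subst_append, h3, ← h2, List.append_assoc]
      have key' : subst v = y → subst [z] = x ++ [b] →
          ∃ v₁ v₂, z :: v = v₁ ++ v₂ ∧ subst v₁ = x ++ [b] ∧ subst v₂ = y :=
        fun h1 h2 => ⟨[z], v, rfl, h2, h1⟩
      cases z
      · rcases x with _ | ⟨c₁, _ | ⟨c₂, x⟩⟩ <;>
          simp [subst_cons_a] at h
        · exact key' h.2.symm (by rw [h.1]; rfl)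
        · obtain ⟨rfl, rfl, h⟩ := h
          exact key x (by simpa using h) rfl
      · rcases x with _ | ⟨c₁, _ | ⟨c₂, _ | ⟨c₃, _ | ⟨c₄, x⟩⟩⟩⟩ <;>
          simp [subst_cons_b] at h
        · obtain ⟨rfl, rfl, rfl, h⟩ := h
          exact key' h.symm rfl
        · obtain ⟨rfl, rfl, rfl, rfl, h⟩ := h
          exact key x (by simpa using h) rfl

/-- Occurrences of `abaaab` start at a cut. -/
theorem eq_nil_or_of_append_eq_subst {v x y : List Letter}
    (h : x ++ ([a, b, a, a, a, b] ++ y) = subst v) (hv : ¬ [b, b] <:+: v) :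
    x = [] ∨ ∃ x', x = x' ++ [b] := by
  induction v generalizing x with
  | nil => simp [subst_nil] at h
  | cons z v ih =>
    have hv' : ¬ [b, b] <:+: v := fun hb => hv (hb.trans (List.suffix_cons z v).isInfix)
    have key : ∀ x' s, x' ++ ([a, b, a, a, a, b] ++ y) = subst v → x = s ++ [b] ++ x' →
        x = [] ∨ ∃ x', x = x' ++ [b] := by
      rintro x' s h1 rfl
      right
      rcases ih h1 hv' with rfl | ⟨x', rfl⟩
      · exact ⟨s, by simp⟩
      · exact ⟨s ++ [b] ++ x', by simp⟩
    cases z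
    · rcases x with _ | ⟨c₁, _ | ⟨c₂, x⟩⟩
      · exact .inl rfl
      · simp [subst_cons_a] at h
      · simp only [List.cons_append, subst_cons_a, List.cons.injEq] at h
        obtain ⟨rfl, rfl, h⟩ := h
        exact key x [a] h rfl
    · rcases x with _ | ⟨c₁, _ | ⟨c₂, _ | ⟨c₃, _ | ⟨c₄, x⟩⟩⟩⟩
      · exact .inl rfl
      · simp [subst_cons_b] at h
      -- The critical case: the occurrence starts at the final `ab` of `φ(b)`. The following `aaab`
      -- forces the next letter of the preimage to be `b`, giving the forbidden `bb`.
      · rcases v with _ | ⟨_ | _, v⟩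
        · simp [subst_cons_b, subst_nil] at h
        · simp [subst_cons_b, subst_cons_a] at h
        · exact (hv ⟨[], v, rfl⟩).elim
      · simp [subst_cons_b] at h
      · simp only [List.cons_append, subst_cons_b, List.cons.injEq] at h
        obtain ⟨rfl, rfl, rfl, rfl, h⟩ := h
        exact key x [a, a, a] h rfl

theorem not_bb_infix_subst (v : List Letter) : ¬ [b, b] <:+: subst v := by
  induction v with
  | nil => simp [subst_nil]
  | cons z v ih =>
    have h : ¬ [b, b] <:+: b :: subst v := by
      rw [List.infix_cons_iff]
      rintro (h | h)
      · rcases v with _ | ⟨_ | _, v⟩ <;> simp [subst_nil, subst_cons_a, subst_cons_b] at h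
      · exact ih h
    cases z <;> simpa [subst_cons_a, subst_cons_b, List.infix_cons_iff] using h

theorem subst_iterate_prefix (n : ℕ) : ∃ t, subst^[n + 2] [a] = [a, b, a, a, a, b] ++ t := by
  induction n with
  | zero => exact ⟨[], rfl⟩
  | succ n ih =>
    obtain ⟨t, ht⟩ := ih
    exact ⟨[a, b, a, b, a, b, a, a, a, b] ++ subst t, by
      rw [Function.iterate_succ_apply', ht]; rfl⟩

theorem exists_subst_eq_append_b {v : List Letter} (hv : v ≠ []) : ∃ x, subst v = x ++ [b] := by
  obtain ⟨t, z, rfl⟩ := List.eq_nil_or_concat v |>.resolve_left hv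
  cases z
  · exact ⟨subst t ++ [a], by simp [subst]⟩
  · exact ⟨subst t ++ [a, a, a], by simp [subst]⟩

/-- Recognizability: occurrences of `φⁿ(abaaab)` start at a cut of order `n`. -/
theorem exists_append_of_append_eq_subst_iterate {n : ℕ} {v x y : List Letter}
    (h : x ++ (subst^[n] [a, b, a, a, a, b] ++ y) = subst^[n] v) (hv : ¬ [b, b] <:+: v) :
    ∃ v₁ v₂, v = v₁ ++ v₂ ∧ subst^[n] v₁ = x := by
  induction n generalizing x y with
  | zero => exact ⟨x, _, h.symm, rfl⟩
  | succ n ih =>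
    have hbb : ¬ [b, b] <:+: subst^[n] v := by
      rcases n with _ | n
      · exact hv
      · rw [Function.iterate_succ_apply']
        exact not_bb_infix_subst _
    rw [Function.iterate_succ_apply', Function.iterate_succ_apply'] at h
    -- The occurrence begins with `abaaab`, so it starts at a cut, and it ends in `b`, so it ends at
    -- a cut. Removing one `φ` leaves an occurrence of `φⁿ(abaaab)`.
    have hQ : ∃ t, subst (subst^[n] [a, b, a, a, a, b]) = [a, b, a, a, a, b] ++ t := by
      obtain ⟨t, ht⟩ := subst_iterate_prefix (n + 1)
      refine ⟨t, ht ▸ ?_⟩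
      rw [← Function.iterate_succ_apply' subst n, Function.iterate_add_apply subst (n + 1) 2]
      rfl
    obtain ⟨t, ht⟩ := hQ
    have hx := eq_nil_or_of_append_eq_subst (x := x) (y := t ++ y)
      (by rw [← List.append_assoc [a, b, a, a, a, b], ← ht]; exact h) hbb
    obtain ⟨v₁, v₂, h1, h2, h3⟩ := exists_append_of_append_eq_subst h hx
    have hne : subst^[n] [a, b, a, a, a, b] ≠ [] := by
      intro h0
      have h4 := subst_iterate_injective n (h0.trans (subst_iterate_nil n).symm)
      cases h4
    obtain ⟨v₃, v₄, h4, h5, h6⟩ := exists_append_of_append_eq_subst h3.symm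
      (.inr (exists_subst_eq_append_b hne))
    rw [subst_injective h5] at h4
    obtain ⟨w₁, w₂, h7, h8⟩ := ih (x := v₁) (y := v₄) (by rw [← h4, ← h1])
    exact ⟨w₁, w₂, h7, by rw [Function.iterate_succ_apply', h8, h2]⟩

/-! ### Factors of long words of the language -/

theorem not_bb_infix_subst_iterate (k : ℕ) (c : Letter) : ¬ [b, b] <:+: subst^[k] [c] := by
  rcases k with _ | k
  · intro h
    simpa using h.length_le
  · rw [Function.iterate_succ_apply']
    exact not_bb_infix_subst _

theorem exists_append_of_append_eq_flatMap {τ : Letter → List Letter} {M : ℕ}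
    (hM : ∀ c, (τ c).length ≤ M) (k : ℕ) {v w y : List Letter} (h : w ++ y = v.flatMap τ)
    (hw : M * k ≤ w.length) (hM0 : 0 < M) :
    ∃ v₁ v₂ t, v = v₁ ++ v₂ ∧ v₁.length = k ∧ w = v₁.flatMap τ ++ t := by
  induction k generalizing v w with
  | zero => exact ⟨[], v, w, rfl, rfl, rfl⟩
  | succ k ih =>
    rcases v with _ | ⟨c, v⟩
    · have h1 := congrArg List.length h
      simp only [List.length_append, List.flatMap_nil, List.length_nil] at h1
      have : M ≤ M * (k + 1) := Nat.le_mul_of_pos_right _ k.succ_pos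
      omega
    · rw [List.flatMap_cons] at h
      have h1 : τ c <+: w := by
        refine List.prefix_of_prefix_length_le (l₃ := w ++ y) ⟨_, h.symm⟩ ⟨_, rfl⟩ ?_
        exact (hM c).trans ((Nat.le_mul_of_pos_right _ k.succ_pos).trans hw)
      obtain ⟨w', rfl⟩ := h1
      rw [List.append_assoc, List.append_cancel_left_eq] at h
      obtain ⟨v₁, v₂, t, rfl, h2, rfl⟩ := ih h (by
        have h3 := hM c
        rw [List.length_append, mul_add] at hw
        omega)
      exact ⟨c :: v₁, v₂, t, rfl, by rw [List.length_cons, h2], by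
        rw [List.flatMap_cons, List.append_assoc]⟩

/-- The extra `M` in `M * (k + 1)` pays for the incomplete block in which `w` may start. -/
theorem exists_infix_of_append_eq_flatMap {τ : Letter → List Letter} {M : ℕ}
    (hM : ∀ c, (τ c).length ≤ M) (k : ℕ) {v w x y : List Letter}
    (h : x ++ (w ++ y) = v.flatMap τ) (hw : M * (k + 1) ≤ w.length) (hM0 : 0 < M) :
    ∃ u s t, u <:+: v ∧ u.length = k ∧ w = s ++ u.flatMap τ ++ t := by
  induction v generalizing x with
  | nil =>
    have h1 := congrArg List.length h
    simp only [List.length_append, List.flatMap_nil, List.length_nil] at h1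
    have : M ≤ M * (k + 1) := Nat.le_mul_of_pos_right _ k.succ_pos
    omega
  | cons c v ih =>
    rw [List.flatMap_cons, List.append_eq_append_iff] at h
    rcases h with ⟨z, h1, h2⟩ | ⟨z, rfl, h2⟩
    · have h3 : z <+: w := by
        refine List.prefix_of_prefix_length_le (l₃ := w ++ y) ⟨_, h2.symm⟩ ⟨_, rfl⟩ ?_
        have h4 := hM c
        rw [h1, List.length_append] at h4
        exact (Nat.le_add_left _ _).trans (h4.trans
          ((Nat.le_mul_of_pos_right _ k.succ_pos).trans hw))
      obtain ⟨w', rfl⟩ := h3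
      rw [List.append_assoc, List.append_cancel_left_eq] at h2
      obtain ⟨v₁, v₂, t, rfl, h3, rfl⟩ := exists_append_of_append_eq_flatMap hM k h2 (by
        have h4 := hM c
        rw [h1, List.length_append] at h4
        rw [List.length_append, mul_add] at hw
        omega) hM0
      exact ⟨v₁, z, t, ⟨[c], v₂, rfl⟩, h3, (List.append_assoc _ _ _).symm⟩
    · obtain ⟨u, s, t, h3, h4, h5⟩ := ih h2.symm
      exact ⟨u, s, t, h3.trans (List.suffix_cons c v).isInfix, h4, h5⟩

theorem subst_iterate_eq_flatMap (n : ℕ) (v : List Letter) :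
    subst^[n] v = v.flatMap fun c => subst^[n] [c] := by
  induction v with
  | nil => exact subst_iterate_nil n
  | cons c v ih => rw [← List.singleton_append, subst_iterate_append, ih]; rfl

theorem subst_iterate_ne_nil (n : ℕ) {v : List Letter} (hv : v ≠ []) : subst^[n] v ≠ [] :=
  fun h => hv (subst_iterate_injective n (h.trans (subst_iterate_nil n).symm))

theorem mem_substLanguage_iff {w : FreeSemigroup Letter} :
    w ∈ substLanguage phi ↔ ∀ᶠ k : ℕ in atTop, ∃ c, w.letters <:+: subst^[k] [c] := by
  simp only [substLanguage, Set.mem_ofPred_eq, FreeSemigroup.isFactor_iff, letters_phi_iterate,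
    FreeSemigroup.letters_of]

theorem mem_substLanguage_of_isInfix {u w : FreeSemigroup Letter} (hw : w ∈ substLanguage phi)
    (h : u.letters <:+: w.letters) : u ∈ substLanguage phi := by
  rw [mem_substLanguage_iff] at hw ⊢
  filter_upwards [hw] with k ⟨c, hc⟩ using ⟨c, h.trans hc⟩

/-- Every sufficiently long word of the language has `φⁿ(a)` as an interior factor. -/
theorem exists_factor_of_length_le (n : ℕ) : ∃ m, ∀ w ∈ substLanguage phi, m ≤ w.letters.length →
    ∃ x y, w = x * phi^[n] (FreeSemigroup.of a) * y := by
  obtain ⟨M, hM0, hM⟩ : ∃ M > 0, ∀ c, (subst^[n] [c]).length ≤ M :=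
    ⟨(subst^[n] [a]).length + (subst^[n] [b]).length + 1, by omega, fun c => by
      cases c <;> omega⟩
  -- Such a word contains the image of four consecutive letters. As `bb` is excluded, one of the two
  -- middle letters is `a`, with nonempty words left on both sides.
  refine ⟨M * (4 + 1), fun w hw hlen => ?_⟩
  obtain ⟨k, ⟨c, s, t, h⟩, hk⟩ := ((mem_substLanguage_iff.mp hw).and (eventually_ge_atTop n)).exists
  obtain ⟨j, rfl⟩ := Nat.exists_eq_add_of_le hk
  rw [Function.iterate_add_apply, subst_iterate_eq_flatMap, List.append_assoc] at h
  obtain ⟨u, x, y, h1, h2, h3⟩ := exists_infix_of_append_eq_flatMap hM 4 h hlen hM0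
  have key : ∀ p q, p ≠ [] → q ≠ [] → u = p ++ [a] ++ q →
      ∃ x y, w = x * phi^[n] (FreeSemigroup.of a) * y := by
    rintro p q hp hq rfl
    rw [List.flatMap_append, List.flatMap_append, ← subst_iterate_eq_flatMap,
      ← subst_iterate_eq_flatMap, ← subst_iterate_eq_flatMap] at h3
    obtain ⟨x', hx'⟩ := FreeSemigroup.exists_letters_eq (l := x ++ subst^[n] p)
      (by simp [subst_iterate_ne_nil n hp])
    obtain ⟨y', hy'⟩ := FreeSemigroup.exists_letters_eq (l := subst^[n] q ++ y)
      (by simp [subst_iterate_ne_nil n hq])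
    refine ⟨x', y', FreeSemigroup.letters_injective ?_⟩
    rw [FreeSemigroup.letters_mul, FreeSemigroup.letters_mul, hx', hy', letters_phi_iterate, h3,
      FreeSemigroup.letters_of]
    simp only [List.append_assoc]
  obtain ⟨u₁, u₂, u₃, u₄, rfl⟩ : ∃ u₁ u₂ u₃ u₄, u = [u₁, u₂, u₃, u₄] := by
    rcases u with _ | ⟨u₁, _ | ⟨u₂, _ | ⟨u₃, _ | ⟨u₄, _ | ⟨_, _⟩⟩⟩⟩⟩ <;> simp at h2
    exact ⟨_, _, _, _, rfl⟩
  cases u₂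
  · exact key [u₁] [u₃, u₄] (by simp) (by simp) rfl
  · cases u₃
    · exact key [u₁, b] [u₄] (by simp) (by simp) rfl
    · exact (not_bb_infix_subst_iterate j c (List.IsInfix.trans ⟨[u₁], [u₄], rfl⟩ h1)).elim

/-- Every word of the language is an interior factor of `φᵏ(a)` for `k` large. -/
theorem eventually_exists_factorization {w : FreeSemigroup Letter} (hw : w ∈ substLanguage phi) :
    ∀ᶠ k : ℕ in atTop, ∃ x y, phi^[k] (FreeSemigroup.of a) = x * w * y := by
  rw [mem_substLanguage_iff, eventually_atTop] at hw
  obtain ⟨N, hN⟩ := hw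
  filter_upwards [eventually_ge_atTop (N + 2)] with k hk
  obtain ⟨j, rfl⟩ := Nat.exists_eq_add_of_le hk
  obtain ⟨c, s, t, h⟩ := hN (N + j) (by omega)
  -- Since `φ²(a) = abaaab` has both letters in its interior, either value of `c` has nonempty
  -- context there.
  have key : ∀ p q, p ≠ [] → q ≠ [] → p ++ [c] ++ q = [a, b, a, a, a, b] →
      ∃ x y, phi^[N + 2 + j] (FreeSemigroup.of a) = x * w * y := by
    intro p q hp hq hpq
    obtain ⟨x, hx⟩ := FreeSemigroup.exists_letters_eq (l := subst^[N + j] p ++ s)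
      (by simp [subst_iterate_ne_nil _ hp])
    obtain ⟨y, hy⟩ := FreeSemigroup.exists_letters_eq (l := t ++ subst^[N + j] q)
      (by simp [subst_iterate_ne_nil _ hq])
    refine ⟨x, y, FreeSemigroup.letters_injective ?_⟩
    rw [letters_phi_iterate, FreeSemigroup.letters_of, show N + 2 + j = N + j + 2 by omega,
      Function.iterate_add_apply]
    change subst^[N + j] [a, b, a, a, a, b] = _
    rw [← hpq, subst_iterate_append, subst_iterate_append, ← h, FreeSemigroup.letters_mul,
      FreeSemigroup.letters_mul, hx, hy]
    simp only [List.append_assoc]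
  cases c
  · exact key [a, b] [a, a, b] (by simp) (by simp) rfl
  · exact key [a] [a, a, a, b] (by simp) (by simp) rfl

end Letter

namespace Letter

open FreeProfiniteSemigroup FreeSemigroup

theorem phi_phi_of_a : phi (phi (of a)) = of a * of b * (of a * of a * of a * of b) := rfl

theorem phi_phi_of_b : phi (phi (of b)) =
    of a * of b * (of a * of b) * (of a * of b) * (of a * of a * of a * of b) := rfl

/-! ### The maximal subgroup containing the images of `φ^ω` -/

theorem singleton_a_prefix_subst_iterate (j : ℕ) : ∃ t, subst^[j] [a] = a :: t := by
  induction j with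
  | zero => exact ⟨[], rfl⟩
  | succ j ih =>
    obtain ⟨t, ht⟩ := ih
    exact ⟨b :: subst t, by rw [Function.iterate_succ_apply', ht, subst_cons_a]⟩

theorem iterate_of_a_mem_substLanguage (k : ℕ) : phi^[k] (of a) ∈ substLanguage phi := by
  rw [mem_substLanguage_iff]
  filter_upwards [eventually_ge_atTop k] with m hm
  obtain ⟨j, rfl⟩ := Nat.exists_eq_add_of_le hm
  obtain ⟨t, ht⟩ := singleton_a_prefix_subst_iterate j
  refine ⟨a, [], subst^[k] t, ?_⟩
  rw [letters_phi_iterate, letters_of, Function.iterate_add_apply, ht,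
    show a :: t = [a] ++ t from rfl,
    subst_iterate_append]
  rfl

theorem omegaPower_a_mem_closure :
    omegaPower phi (of a) ∈ closure (wordToProfinite Letter '' substLanguage phi) :=
  mem_closure_of_tendsto (tendsto_omegaPower phi (of a))
    (Eventually.of_forall fun _ => ⟨_, iterate_of_a_mem_substLanguage _, rfl⟩)

theorem exists_iterate_of_a_eq_mul (n : ℕ) : ∃ w, phi^[n + 1] (of a) = w * of b := by
  induction n with
  | zero => exact ⟨of a, rfl⟩
  | succ n ih =>
    obtain ⟨w, hw⟩ := ih
    exact ⟨phi w * (of a * of a * of a), by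
      rw [Function.iterate_succ_apply', hw, map_mul, mul_assoc]; rfl⟩

theorem exists_iterate_of_b_eq_mul (n : ℕ) : ∃ w, phi^[n + 1] (of b) = of a * w := by
  induction n with
  | zero => exact ⟨of a * of a * of b, rfl⟩
  | succ n ih =>
    obtain ⟨w, hw⟩ := ih
    exact ⟨of b * phi w, by
      rw [Function.iterate_succ_apply', hw, map_mul, ← mul_assoc]; rfl⟩

theorem exists_iterate_of_a_eq_mul_mul (n : ℕ) :
    ∃ w, phi^[n + 2] (of a) = of a * of b * (of a * of a) * w := by
  obtain ⟨t, ht⟩ := subst_iterate_prefix n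
  obtain ⟨w, hw⟩ := exists_letters_eq (l := a :: b :: t) (by simp)
  refine ⟨w, letters_injective ?_⟩
  rw [letters_phi_iterate, letters_of, ht, letters_mul, hw]
  rfl

/-- By compactness the right multiples of `φ^ω(v)` form a closed set, and `φ^ω(u)` is a limit of the
elements `φ^ω(φ^{n!}(u))` of it. -/
theorem exists_omegaPower_eq_mul {u v : FreeSemigroup Letter}
    (h : ∀ᶠ n in atTop, ∃ w, phi^[n] u = v * w) :
    ∃ r, omegaPower phi u = omegaPower phi v * r := by
  have hcl : IsClosed (Set.range fun r => omegaPower phi v * r) :=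
    (isCompact_range (by fun_prop)).isClosed
  obtain ⟨r, hr⟩ := hcl.mem_of_tendsto (tendsto_omegaPower_iterate phi u) (by
    filter_upwards [factorial_tendsto_atTop.eventually h] with n hn
    obtain ⟨w, hw⟩ := hn
    exact ⟨omegaPower phi w, by rw [hw, map_mul]⟩)
  exact ⟨r, hr.symm⟩

theorem exists_omegaPower_eq_mul_left {u v : FreeSemigroup Letter}
    (h : ∀ᶠ n in atTop, ∃ w, phi^[n] u = w * v) :
    ∃ r, omegaPower phi u = r * omegaPower phi v := by
  have hcl : IsClosed (Set.range fun r => r * omegaPower phi v) :=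
    (isCompact_range (by fun_prop)).isClosed
  obtain ⟨r, hr⟩ := hcl.mem_of_tendsto (tendsto_omegaPower_iterate phi u) (by
    filter_upwards [factorial_tendsto_atTop.eventually h] with n hn
    obtain ⟨w, hw⟩ := hn
    exact ⟨omegaPower phi w, by rw [hw, map_mul]⟩)
  exact ⟨r, hr.symm⟩

/-- High iterates of `a` start with `abaa` and end with `b`, and those of `b` start with `a`. In the
limit these become the divisibilities required by `exists_idempotent_of_factorizations`. -/
theorem exists_maximalSubgroup_omegaPower :
    ∃ (e : FreeProfiniteSemigroup Letter) (he : IsIdempotentElem e)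
      (g : Letter → MaximalSubgroup e he), ∀ x, (g x).1 = omegaPower phi (of x) := by
  obtain ⟨r, hr⟩ : ∃ r, omegaPower phi (of a) =
      omegaPower phi (of a * of b * (of a * of a)) * r := by
    refine exists_omegaPower_eq_mul ?_
    filter_upwards [eventually_ge_atTop 2] with n hn
    obtain ⟨n, rfl⟩ := Nat.exists_eq_add_of_le' hn
    exact exists_iterate_of_a_eq_mul_mul n
  obtain ⟨s, hs⟩ : ∃ s, omegaPower phi (of a) = s * omegaPower phi (of b) := by
    refine exists_omegaPower_eq_mul_left ?_
    filter_upwards [eventually_ge_atTop 1] with n hn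
    obtain ⟨n, rfl⟩ := Nat.exists_eq_add_of_le' hn
    exact exists_iterate_of_a_eq_mul n
  obtain ⟨t, ht⟩ : ∃ t, omegaPower phi (of b) = omegaPower phi (of a) * t := by
    refine exists_omegaPower_eq_mul ?_
    filter_upwards [eventually_ge_atTop 1] with n hn
    obtain ⟨n, rfl⟩ := Nat.exists_eq_add_of_le' hn
    exact exists_iterate_of_b_eq_mul n
  rw [map_mul, map_mul, map_mul] at hr
  obtain ⟨e, he, h1, h2⟩ := MaximalSubgroup.exists_idempotent_of_factorizations hr hs ht
  exact ⟨e, he, fun x => match x with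
    | a => ⟨_, h1⟩
    | b => ⟨_, h2⟩, fun x => by cases x <;> rfl⟩

/-! ### Idempotents in the `J`-class -/

/-- The language is closed under prefixes, and openness of multiplication passes this to its
closure. -/
theorem mem_closure_of_mul_mem_closure {x y : FreeProfiniteSemigroup Letter}
    (h : x * y ∈ closure (wordToProfinite Letter '' substLanguage phi)) :
    x ∈ closure (wordToProfinite Letter '' substLanguage phi) := by
  refine FreeProfiniteSemigroup.mem_closure_iff.mpr fun c => ?_
  obtain ⟨u, v, huv, h1, -⟩ := exists_mul_mem_of_mul_mem_closure h c
  exact ⟨u, mem_substLanguage_of_isInfix huv ⟨[], v.letters, rfl⟩, h1⟩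

theorem wordToProfinite_injective : Function.Injective (wordToProfinite Letter) := by
  intro u v h
  have h1 := congrArg (proj (FiniteIndexCon.prefixes (u.letters.length + 1))) h
  exact FiniteIndexCon.eq_of_mk_prefixes_eq h1 (Nat.lt_succ_self _)

theorem wordToProfinite_ne_of_isIdempotentElem {e : FreeProfiniteSemigroup Letter}
    (he : IsIdempotentElem e) (w : FreeSemigroup Letter) : wordToProfinite Letter w ≠ e := by
  rintro rfl
  have h := congrArg (fun w => w.letters.length) (wordToProfinite_injective
    ((map_mul (wordToProfinite Letter) w w).trans he))
  simp only [letters_mul, List.length_append] at h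
  exact letters_ne_nil w (List.length_eq_zero_iff.mp (by omega))

/-! ### Generators and finite quotients of the maximal subgroup -/

section Group

variable {e : FreeProfiniteSemigroup Letter} {he : IsIdempotentElem e}
  {g : Letter → MaximalSubgroup e he}

/-- In a group every element is a prefix of every other one, in particular of `φ^ω(a)`. -/
theorem val_mem_closure (hg : ∀ x, (g x).1 = omegaPower phi (of x))
    (h : MaximalSubgroup e he) : h.1 ∈ closure (wordToProfinite Letter '' substLanguage phi) := by
  refine mem_closure_of_mul_mem_closure (y := (h⁻¹ * g a).1) ?_
  rw [← MaximalSubgroup.val_mul, mul_inv_cancel_left, hg]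
  exact omegaPower_a_mem_closure

theorem isIdempotentElem_mem_substJClass (hg : ∀ x, (g x).1 = omegaPower phi (of x)) :
    e ∈ substJClass phi :=
  ⟨val_mem_closure hg 1, fun ⟨w, _, hw⟩ => wordToProfinite_ne_of_isIdempotentElem he w hw⟩

theorem val_lift (hg : ∀ x, (g x).1 = omegaPower phi (of x)) (w : FreeSemigroup Letter) :
    (lift g w).1 = omegaPower phi w := by
  induction w with
  | ih1 x => exact hg x
  | ih2 x y hx hy => rw [map_mul, MaximalSubgroup.val_mul, hx, hy, map_mul]

/-- Words approximating an element of the maximal subgroup start with `φⁿ(abaaab)`. -/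
theorem iterate_prefix_of_proj_eq (hg : ∀ x, (g x).1 = omegaPower phi (of x))
    (h : MaximalSubgroup e he) {n : ℕ} {u : FreeSemigroup Letter}
    (hu : proj (FiniteIndexCon.prefixes (subst^[n] [a, b, a, a, a, b]).length) h.1 =
      FiniteIndexCon.mk _ u) : subst^[n] [a, b, a, a, a, b] <+: u.letters := by
  obtain ⟨d, hd, hP⟩ := exists_proj_omegaPower phi
    (FiniteIndexCon.prefixes (subst^[n] [a, b, a, a, a, b]).length)
  obtain ⟨z, hz, -⟩ := exists_word (g⁻¹ a * h).1
    (FiniteIndexCon.prefixes (subst^[n] [a, b, a, a, a, b]).length)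
    (FiniteIndexCon.prefixes (subst^[n] [a, b, a, a, a, b]).length)
  have h1 : h.1 = omegaPower phi (of a) * (g⁻¹ a * h).1 := by
    rw [← hg, ← MaximalSubgroup.val_mul, Pi.inv_apply, mul_inv_cancel_left]
  -- Modulo the prefix congruence `φ^ω(a)` becomes `φ^{d(n+2)}(a)`. The exponent is a multiple of
  -- `d` and at least `n + 2`, so this word starts with `φ^{n+2}(a) = φⁿ(abaaab)`.
  rw [h1, map_mul, hz, hP (d * (n + 2)) (by positivity) (dvd_mul_right _ _),
    ← FiniteIndexCon.mk_mul] at hu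
  have hQ : subst^[n] [a, b, a, a, a, b] = (phi^[n + 2] (of a)).letters := by
    rw [letters_phi_iterate, Function.iterate_add_apply]
    rfl
  rw [hQ] at hu ⊢
  refine FiniteIndexCon.prefix_of_mk_prefixes_eq hu.symm rfl ?_
  rw [letters_mul]
  refine List.IsPrefix.trans ?_ (List.prefix_append _ _)
  obtain ⟨j, hj⟩ := Nat.exists_eq_add_of_le (Nat.le_mul_of_pos_left (n + 2) hd)
  obtain ⟨t, ht⟩ := singleton_a_prefix_subst_iterate j
  rw [letters_phi_iterate, letters_phi_iterate, letters_of, hj,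
    Function.iterate_add_apply subst (n + 2), ht,
    show a :: t = [a] ++ t from rfl, subst_iterate_append]
  exact List.prefix_append _ _

/-- The maximal subgroup is topologically generated by `φ^ω(a)` and `φ^ω(b)`. -/
theorem denseRange_lift (hg : ∀ x, (g x).1 = omegaPower phi (of x)) :
    DenseRange (lift g : FreeSemigroup Letter →ₙ* MaximalSubgroup e he) := by
  intro h
  refine closure_subtype.mpr ?_
  refine mem_closure_iff_proj.mpr fun c => ?_
  obtain ⟨N, hN, hP⟩ := exists_proj_omegaPower phi c
  set q := subst^[N] [a, b, a, a, a, b] with hq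
  -- The extra factor `g a` marks the end of `u`. Both `u` and `v` start with `φᴺ(abaaab)`, so by
  -- recognizability both ends of `u` are cuts of order `N`. Hence `u = φᴺ(w)`, which agrees with
  -- `φ^ω(w)` modulo `c`.
  obtain ⟨u, v, huv, hu, hv⟩ := exists_mul_mem_of_mul_mem_closure
    (val_mem_closure hg (h * g a)) (c.inf (FiniteIndexCon.prefixes q.length))
  have hu1 : proj c h.1 = c.mk u :=
    proj_eq_of_proj_eq hu fun _ h' => (FiniteIndexCon.mk_inf_eq_iff.mp h').1
  obtain ⟨u', hu'⟩ := iterate_prefix_of_proj_eq (n := N) hg h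
    (proj_eq_of_proj_eq hu fun _ h' => (FiniteIndexCon.mk_inf_eq_iff.mp h').2)
  obtain ⟨v', hv'⟩ := iterate_prefix_of_proj_eq (n := N) hg (g a)
    (proj_eq_of_proj_eq hv fun _ h' => (FiniteIndexCon.mk_inf_eq_iff.mp h').2)
  obtain ⟨k, ⟨l, x, y, hxy⟩, hk⟩ :=
    ((mem_substLanguage_iff.mp huv).and (eventually_ge_atTop N)).exists
  obtain ⟨j, rfl⟩ := Nat.exists_eq_add_of_le hk
  rw [Function.iterate_add_apply, letters_mul] at hxy
  have hbb := not_bb_infix_subst_iterate j l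
  obtain ⟨v₁, v₂, h1, h2⟩ := exists_append_of_append_eq_subst_iterate (n := N) (x := x)
    (y := u' ++ v.letters ++ y) (by rw [← hxy, ← hu']; simp only [List.append_assoc]) hbb
  obtain ⟨v₃, v₄, h3, h4⟩ := exists_append_of_append_eq_subst_iterate (n := N)
    (x := x ++ u.letters) (y := v' ++ y)
    (by rw [← hxy, ← hv']; simp only [List.append_assoc]) hbb
  obtain ⟨z, hz⟩ : ∃ z, subst^[N] z = u.letters := by
    rcases List.append_eq_append_iff.mp (h1.symm.trans h3) with ⟨z, rfl, -⟩ | ⟨z, rfl, -⟩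
    · rw [subst_iterate_append, h2, List.append_cancel_left_eq] at h4
      exact ⟨z, h4⟩
    · rw [subst_iterate_append, h4] at h2
      have h5 := congrArg List.length h2
      simp only [List.length_append] at h5
      exact (letters_ne_nil u (List.length_eq_zero_iff.mp (by omega))).elim
  obtain ⟨w, rfl⟩ := exists_letters_eq (l := z) (by
    rintro rfl
    rw [subst_iterate_nil] at hz
    exact letters_ne_nil u hz.symm)
  rw [← letters_phi_iterate] at hz
  refine ⟨_, ⟨_, ⟨w, rfl⟩, rfl⟩, ?_⟩
  change proj c (lift g w).1 = _
  rw [val_lift hg, hu1, hP N hN dvd_rfl, letters_injective hz]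

/-- The maximal subgroup has no quotient of order two. -/
theorem eq_one_of_isOpen_ker (hg : ∀ x, (g x).1 = omegaPower phi (of x))
    (χ : MaximalSubgroup e he →* Multiplicative (ZMod 2))
    (hχ : IsOpen (χ.ker : Set (MaximalSubgroup e he))) : χ = 1 := by
  have hcl : IsClosed (χ.ker : Set (MaximalSubgroup e he)) := χ.ker.isClosed_of_isOpen hχ
  have h1 : ∀ w, χ (lift g (phi (phi w))) = 1 := by
    -- The exponents of `(s, t)` are `(4, 2)` and `(6, 4)`, all even.
    have key : ∀ s t : Multiplicative (ZMod 2), s * t * (s * s * s * t) = 1 ∧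
        s * t * (s * t) * (s * t) * (s * s * s * t) = 1 := by decide
    intro w
    induction w with
    | ih1 x =>
      cases x
      · rw [phi_phi_of_a]
        simp only [map_mul]
        exact (key _ _).1
      · rw [phi_phi_of_b]
        simp only [map_mul]
        exact (key _ _).2
    | ih2 x y hx hy => rw [map_mul, map_mul, map_mul, map_mul, hx, hy, one_mul]
  have h2 : ∀ w, lift g w ∈ χ.ker := by
    intro w
    have ht : Tendsto (fun n : ℕ => lift g (phi^[n.factorial] w)) atTop (𝓝 (lift g w)) := by
      refine tendsto_subtype_rng.mpr ?_
      rw [val_lift hg]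
      exact (tendsto_omegaPower_iterate phi w).congr fun n => (val_lift hg _).symm
    refine hcl.mem_of_tendsto ht ?_
    filter_upwards [factorial_tendsto_atTop.eventually (eventually_ge_atTop 2)] with n hn
    obtain ⟨k, hk⟩ := Nat.exists_eq_add_of_le hn
    rw [hk, Function.iterate_add_apply]
    exact h1 _
  ext h
  have h3 : h ∈ closure (Set.range (lift g)) := denseRange_lift hg h
  exact congrArg _ (closure_minimal (by rintro _ ⟨w, rfl⟩; exact h2 w) hcl h3)

/-- The maximal subgroup has a finite continuous quotient with an element of order two. -/
theorem exists_openNormalSubgroup (hg : ∀ x, (g x).1 = omegaPower phi (of x)) :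
    ∃ N : OpenNormalSubgroup (MaximalSubgroup e he), ∃ h, h ∉ N ∧ h * h ∈ N := by
  -- A 3-cycle and a double transposition with `x³ = y² = (xy)³ = 1`; the first two equations say
  -- that `φ²` fixes the pair `(x, y)`.
  obtain ⟨x, y, hx, hy, hy1, hy2⟩ : ∃ x y : Equiv.Perm (Fin 4), x * y * (x * x * x * y) = x ∧
      x * y * (x * y) * (x * y) * (x * x * x * y) = y ∧ y ≠ 1 ∧ y * y = 1 :=
    ⟨Equiv.swap 0 1 * Equiv.swap 1 2, Equiv.swap 0 1 * Equiv.swap 2 3, by decide, by decide,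
      by decide, by decide⟩
  obtain ⟨f, hfa, hfb⟩ : ∃ f : FreeSemigroup Letter →ₙ* Equiv.Perm (Fin 4),
      f (of a) = x ∧ f (of b) = y :=
    ⟨lift fun c => match c with
      | a => x
      | b => y, rfl, rfl⟩
  let _ : TopologicalSpace (Equiv.Perm (Fin 4)) := ⊥
  have _ : DiscreteTopology (Equiv.Perm (Fin 4)) := ⟨rfl⟩
  have hf : ∀ w, f (phi (phi w)) = f w := by
    intro w
    induction w with
    | ih1 c =>
      cases c
      · rw [phi_phi_of_a]
        simp only [map_mul, hfa, hfb, hx]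
      · rw [phi_phi_of_b]
        simp only [map_mul, hfa, hfb, hy]
    | ih2 u v hu hv => rw [map_mul, map_mul, map_mul, map_mul, hu, hv]
  have hf' : ∀ n w, f (phi^[2 * n] w) = f w := by
    intro n w
    induction n with
    | zero => rfl
    | succ n ih =>
      rw [show 2 * (n + 1) = 2 + 2 * n by ring, Function.iterate_add_apply]
      exact (hf _).trans ih
  obtain ⟨F, hF, hFf⟩ := exists_extension f
  have hFb : F (omegaPower phi (of b)) = y := by
    refine tendsto_nhds_unique ((hF.tendsto _).comp (tendsto_omegaPower phi (of b))) ?_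
    refine tendsto_const_nhds.congr' ?_
    filter_upwards [eventually_ge_atTop 2] with n hn
    obtain ⟨k, hk⟩ := Nat.dvd_factorial two_pos hn
    rw [Function.comp_apply, hFf, hk, hf', hfb]
  let χ : MaximalSubgroup e he →* Equiv.Perm (Fin 4) :=
    MonoidHom.mk' (fun h => F h.1) fun h h' => by rw [MaximalSubgroup.val_mul, map_mul]
  have hχ : IsOpen (χ.ker : Set (MaximalSubgroup e he)) :=
    (isOpen_discrete {1}).preimage (hF.comp MaximalSubgroup.continuous_val)
  have hb : χ (g b) = y := by
    change F (g b).1 = y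
    rw [hg, hFb]
  refine ⟨{ toSubgroup := χ.ker, isOpen' := hχ }, g b, fun h => ?_, ?_⟩
  · have h1 : χ (g b) = 1 := h
    rw [hb] at h1
    exact hy1 h1
  · change χ (g b * g b) = 1
    rw [map_mul, hb, hy2]

end Group

end Letter

/-! ### Independence of the choice of idempotent -/

namespace Letter

open FreeProfiniteSemigroup FreeSemigroup

/-- The relation of being an interior factor is closed by compactness. It passes to the limit first
along `φ^{n!}(a)` for a fixed word, then along words tending to `z`. -/
theorem exists_omegaPower_eq_mul_mul {z : FreeProfiniteSemigroup Letter}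
    (hz : z ∈ closure (wordToProfinite Letter '' substLanguage phi)) :
    ∃ x y, omegaPower phi (of a) = x * z * y := by
  have hcl : IsClosed (Set.range fun p : FreeProfiniteSemigroup Letter ×
      FreeProfiniteSemigroup Letter × FreeProfiniteSemigroup Letter =>
        (p.1 * p.2.1 * p.2.2, p.2.1)) :=
    (isCompact_range (by fun_prop)).isClosed
  have h1 : wordToProfinite Letter '' substLanguage phi ⊆
      (fun z => (omegaPower phi (of a), z)) ⁻¹' Set.range fun p : FreeProfiniteSemigroup Letter ×
      FreeProfiniteSemigroup Letter × FreeProfiniteSemigroup Letter =>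
        (p.1 * p.2.1 * p.2.2, p.2.1) := by
    rintro _ ⟨w, hw, rfl⟩
    refine hcl.mem_of_tendsto (Tendsto.prodMk_nhds (tendsto_omegaPower phi (of a))
      tendsto_const_nhds) ?_
    filter_upwards [factorial_tendsto_atTop.eventually (eventually_exists_factorization hw)]
      with n hn
    obtain ⟨x, y, hxy⟩ := hn
    exact ⟨(wordToProfinite Letter x, wordToProfinite Letter w, wordToProfinite Letter y), by
      rw [hxy, map_mul, map_mul]⟩
  obtain ⟨⟨x, z', y⟩, h⟩ := closure_minimal h1 (hcl.preimage (by fun_prop)) hz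
  obtain ⟨h2, rfl⟩ := Prod.mk.inj h
  exact ⟨x, y, h2.symm⟩

/-- The words of the language without the interior factor `φⁿ(a)` have bounded length, so they form
a finite closed set that misses `z`. Thus `z` has every `φⁿ(a)` as a factor, and then also the limit
`φ^ω(a)`. -/
theorem exists_eq_mul_omegaPower_mul {z : FreeProfiniteSemigroup Letter}
    (hz : z ∈ substJClass phi) : ∃ x y, z = x * omegaPower phi (of a) * y := by
  have hcl : IsClosed (Set.range fun p : FreeProfiniteSemigroup Letter ×
      FreeProfiniteSemigroup Letter × FreeProfiniteSemigroup Letter =>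
        (p.1 * p.2.1 * p.2.2, p.2.1)) :=
    (isCompact_range (by fun_prop)).isClosed
  have key : ∀ n, (z, wordToProfinite Letter (phi^[n] (of a))) ∈
      Set.range fun p : FreeProfiniteSemigroup Letter ×
      FreeProfiniteSemigroup Letter × FreeProfiniteSemigroup Letter =>
        (p.1 * p.2.1 * p.2.2, p.2.1) := by
    intro n
    obtain ⟨m, hm⟩ := exists_factor_of_length_le n
    have hfin : (wordToProfinite Letter ''
        { w ∈ substLanguage phi | w.letters.length < m }).Finite := by
      refine Set.Finite.image _ ?_
      refine Set.Finite.of_finite_image ((List.finite_length_lt Letter m).subset ?_)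
        letters_injective.injOn
      rintro _ ⟨w, hw, rfl⟩
      exact hw.2
    have hunion : wordToProfinite Letter '' substLanguage phi ⊆
        wordToProfinite Letter '' { w ∈ substLanguage phi | w.letters.length < m } ∪
        (fun z => (z, wordToProfinite Letter (phi^[n] (of a)))) ⁻¹'
          Set.range fun p : FreeProfiniteSemigroup Letter ×
          FreeProfiniteSemigroup Letter × FreeProfiniteSemigroup Letter =>
            (p.1 * p.2.1 * p.2.2, p.2.1) := by
      rintro _ ⟨w, hw, rfl⟩
      rcases lt_or_ge w.letters.length m with h | h
      · exact .inl ⟨w, ⟨hw, h⟩, rfl⟩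
      · obtain ⟨x, y, hxy⟩ := hm w hw h
        exact .inr ⟨(wordToProfinite Letter x, wordToProfinite Letter (phi^[n] (of a)),
          wordToProfinite Letter y), by rw [hxy, map_mul, map_mul]⟩
    rcases closure_minimal hunion (hfin.isClosed.union (hcl.preimage (by fun_prop))) hz.1 with h | h
    · obtain ⟨w, hw, rfl⟩ := h
      exact (hz.2 ⟨w, hw.1, rfl⟩).elim
    · exact h
  obtain ⟨⟨x, z', y⟩, h⟩ := hcl.mem_of_tendsto (Tendsto.prodMk_nhds tendsto_const_nhds
    (tendsto_omegaPower phi (of a))) (Eventually.of_forall fun n => key n.factorial)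
  obtain ⟨h2, rfl⟩ := Prod.mk.inj h
  exact ⟨x, y, h2.symm⟩

theorem exists_continuousMulEquiv {e f : FreeProfiniteSemigroup Letter} {he : IsIdempotentElem e}
    {hf : IsIdempotentElem f} {g : Letter → MaximalSubgroup e he}
    (hg : ∀ x, (g x).1 = omegaPower phi (of x)) (hfJ : f ∈ substJClass phi) :
    Nonempty (MaximalSubgroup f hf ≃ₜ* MaximalSubgroup e he) := by
  obtain ⟨x, y, hxy⟩ := exists_eq_mul_omegaPower_mul hfJ
  obtain ⟨p, q, hpq⟩ := exists_omegaPower_eq_mul_mul hfJ.1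
  rw [← hg] at hxy hpq
  have h1 : f = x * e * ((g a).1 * y) := by
    calc f = x * (e * (g a).1) * y := by rw [(g a).2.1, ← hxy]
      _ = _ := by simp only [mul_assoc]
  have h2 : e = p * f * (q * (g a)⁻¹.1) := by
    calc e = (g a).1 * (g a)⁻¹.1 :=
          (congrArg Subtype.val (mul_inv_cancel (g a))).symm
      _ = p * f * q * (g a)⁻¹.1 := by rw [← hpq]
      _ = _ := by simp only [mul_assoc]
  obtain ⟨u, v, hu, hu', hv, hv', huv, hvu⟩ := exists_conjugate_of_isIdempotentElem hf he h1 h2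
  exact MaximalSubgroup.exists_continuousMulEquiv hf he hu hu' hv hv' huv hvu

end Letter

/-! ### Relatively free profinite groups -/

/-- An element of order at most two defines a homomorphism from the group of order two. -/
theorem exists_monoidHom_of_mul_self_eq_one {Q : Type*} [Group Q] {q : Q} (hq : q * q = 1)
    (hq1 : q ≠ 1) : ∃ f : Multiplicative (ZMod 2) →* Q, Function.Injective f := by
  let f : Multiplicative (ZMod 2) →* Q :=
    AddMonoidHom.toMultiplicativeLeft (ZMod.lift 2 ⟨zmultiplesHom (Additive Q) (Additive.ofMul q), by
      change ((2 : ℕ) : ℤ) • Additive.ofMul q = 0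
      rw [natCast_zsmul, two_nsmul]
      exact hq⟩)
  have hf : f (Multiplicative.ofAdd 1) = q := by
    refine congrArg Additive.toMul ((ZMod.lift_coe 2 _ 1).trans ?_)
    exact one_zsmul (Additive.ofMul q)
  refine ⟨f, (injective_iff_map_eq_one f).mpr fun x hx => ?_⟩
  have key : ∀ x : Multiplicative (ZMod 2), x = 1 ∨ x = Multiplicative.ofAdd 1 := by decide
  rcases key x with rfl | rfl
  · rfl
  · exact (hq1 (hf.symm.trans hx)).elim

/-- A profinite group with a finite continuous quotient of even order but without quotients of
order two is not relatively free. -/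
theorem not_isRelativelyFree {H : Type} [Group H] [TopologicalSpace H] [IsTopologicalGroup H]
    [CompactSpace H] [T2Space H] [TotallyDisconnectedSpace H]
    (h1 : ∀ χ : H →* Multiplicative (ZMod 2), IsOpen (χ.ker : Set H) → χ = 1)
    (h2 : ∃ N : OpenNormalSubgroup H, ∃ h, h ∉ N ∧ h * h ∈ N) : ¬ IsRelativelyFree H := by
  rintro ⟨V, X, ι, hV, hfree⟩
  obtain ⟨N, h, hN, hhN⟩ := h2
  obtain ⟨f, hf⟩ := exists_monoidHom_of_mul_self_eq_one (q := (h : H ⧸ N.toSubgroup))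
    ((QuotientGroup.eq_one_iff (h * h)).mpr hhN) fun h0 => hN ((QuotientGroup.eq_one_iff h).mp h0)
  -- The group of order two embeds in the finite quotient by `N`, which lies in `V`.
  have hC2 : V.Mem (Multiplicative (ZMod 2)) := V.subgroup _ _ f hf (hV N)
  let _ : TopologicalSpace (Multiplicative (ZMod 2)) := ⊥
  have _ : DiscreteTopology (Multiplicative (ZMod 2)) := ⟨rfl⟩
  have hpro : IsPro V (Multiplicative (ZMod 2)) := fun M =>
    V.quotient _ _ (QuotientGroup.mk' M.toSubgroup) (QuotientGroup.mk'_surjective _) hC2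
  rcases isEmpty_or_nonempty X with hX | ⟨⟨x⟩⟩
  -- With no generators, uniqueness identifies the identity of `H` with the trivial endomorphism.
  · obtain ⟨g, -, hg⟩ := hfree H hV ι
    have h3 : ContinuousMonoidHom.id H = (1 : H →ₜ* H) :=
      (hg _ fun x => hX.elim x).trans (hg _ fun x => hX.elim x).symm
    have h4 : h = 1 := DFunLike.congr_fun h3 h
    exact hN (h4 ▸ one_mem N.toSubgroup)
  · obtain ⟨g, hg, -⟩ := hfree _ hpro fun _ => Multiplicative.ofAdd 1
    have h3 : (g : H →* Multiplicative (ZMod 2)) = 1 :=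
      h1 _ ((isOpen_discrete {1}).preimage g.continuous_toFun)
    have h4 : g (ι x) = 1 := DFunLike.congr_fun h3 (ι x)
    rw [hg x] at h4
    exact absurd h4 (by decide)

theorem theoremt :
    (∃ e ∈ substJClass phi, IsIdempotentElem e) ∧
      ∀ e ∈ substJClass phi, ∀ he : IsIdempotentElem e,
        ¬ IsRelativelyFree (MaximalSubgroup e he) := by
  obtain ⟨e, he, g, hg⟩ := Letter.exists_maximalSubgroup_omegaPower
  refine ⟨⟨e, Letter.isIdempotentElem_mem_substJClass hg, he⟩, fun f hfJ hf => ?_⟩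
  obtain ⟨j⟩ := Letter.exists_continuousMulEquiv (hf := hf) hg hfJ
  refine not_isRelativelyFree (fun χ hχ => ?_) ?_
  · have h1 := Letter.eq_one_of_isOpen_ker hg (χ.comp j.symm.toMulEquiv.toMonoidHom)
      (hχ.preimage j.symm.continuous)
    refine MonoidHom.ext fun x => ?_
    have h2 : χ (j.symm (j x)) = 1 := DFunLike.congr_fun h1 (j x)
    rwa [j.symm_apply_apply] at h2
  · obtain ⟨N, h, hN, hhN⟩ := Letter.exists_openNormalSubgroup hg
    refine ⟨{ toSubgroup := N.toSubgroup.comap j.toMulEquiv.toMonoidHom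
              isOpen' := N.isOpen'.preimage j.continuous
              isNormal' := Subgroup.Normal.comap N.isNormal' _ }, j.symm h, fun h1 => hN ?_, ?_⟩
    · have h2 : j (j.symm h) ∈ N := h1
      rwa [j.apply_symm_apply] at h2
    · change j (j.symm h * j.symm h) ∈ N
      rwa [map_mul, j.apply_symm_apply]
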